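/- Let $n\ge 3$ and let $(M^n,g)$ be a compact connected smooth Riemannian manifold whose boundary $\partial M$ is non-empty and connected. A non-constant smooth function $f:M\to\mathbb R$ is called isoparametric for a Riemannian metric $h$ on $M$ if $\|\nabla_h f\|_h^2=b\circ f$ and $\Delta_h f=a\circ f$ for some smooth functions $a,b:f(M)\to\mathbb R$, and $f$ is locally constant on $\partial M$. Assume that $f$ is isoparametric for $g$, and let $[g]_f$ be the set of all metrics $h=\phi g$, with $\phi>0$ a smooth function on $M$, for which $f$ is isoparametric. Then: 1. $[g]_f$ contains at most one metric that has volume $1$, is scalar flat, and for which $\partial M$ has constant mean curvature. 2. If $g_1,g_2\in[g]_f$ are scalar flat and $\partial M$ has constant mean curvature with respect to each of them, then $g_2=u^{\frac{4}{n-2}}g_1$ for a positive smooth function $u$ on $M$ such that $\Delta_{g_1}u=0$ on $M$, $u$ is constant on $\partial M$, and $u$ is constant on $M$. -/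

import Mathlib

open Set MeasureTheory
open scoped Manifold ContDiff ENNReal

noncomputable section

namespace BoundaryConformal

/-! ### Tensor calculus in one coordinate chart

Coordinates take values in the closed half-space `range (𝓡∂ n) = {y | 0 ≤ y 0}` of `ℝⁿ`; all
derivatives are taken within this half-space, so that they are one-sided at points of its boundary.
`G y` is the matrix of a Riemannian metric in the coordinates. -/

section Coordinates

variable {n : ℕ} [NeZero n]

/-- The partial derivative `∂_i F` at `y`, within the closed half-space. -/
def pd (i : Fin n) (F : EuclideanSpace ℝ (Fin n) → ℝ) (y : EuclideanSpace ℝ (Fin n)) : ℝ :=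
  fderivWithin ℝ F (range (𝓡∂ n)) y (EuclideanSpace.single i 1)

/-- The Christoffel symbol
`Γ^k_{ij} = ½ ∑_l G^{kl} (∂_i G_{jl} + ∂_j G_{il} - ∂_l G_{ij})`. -/
def christoffel (G : EuclideanSpace ℝ (Fin n) → Matrix (Fin n) (Fin n) ℝ) (k i j : Fin n)
    (y : EuclideanSpace ℝ (Fin n)) : ℝ :=
  (1 / 2) * ∑ l, (G y)⁻¹ k l *
    (pd i (fun z => G z j l) y + pd j (fun z => G z i l) y - pd l (fun z => G z i j) y)

/-- The Ricci tensor
`R_{ij} = ∂_k Γ^k_{ij} - ∂_j Γ^k_{ik} + Γ^k_{kl} Γ^l_{ij} - Γ^k_{jl} Γ^l_{ik}`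
(positive on round spheres). -/
def ricci (G : EuclideanSpace ℝ (Fin n) → Matrix (Fin n) (Fin n) ℝ) (i j : Fin n)
    (y : EuclideanSpace ℝ (Fin n)) : ℝ :=
  ∑ k, (pd k (christoffel G k i j) y - pd j (christoffel G k i k) y
    + ∑ l, (christoffel G k k l y * christoffel G l i j y
      - christoffel G k j l y * christoffel G l i k y))

/-- The scalar curvature `G^{ij} R_{ij}`. -/
def coordScalar (G : EuclideanSpace ℝ (Fin n) → Matrix (Fin n) (Fin n) ℝ)
    (y : EuclideanSpace ℝ (Fin n)) : ℝ :=
  ∑ i, ∑ j, (G y)⁻¹ i j * ricci G i j y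

/-- The Laplace-Beltrami operator `G^{ij} (∂_i ∂_j F - Γ^k_{ij} ∂_k F)`, that is `div ∇ F`. -/
def coordLaplacian (G : EuclideanSpace ℝ (Fin n) → Matrix (Fin n) (Fin n) ℝ)
    (F : EuclideanSpace ℝ (Fin n) → ℝ) (y : EuclideanSpace ℝ (Fin n)) : ℝ :=
  ∑ i, ∑ j, (G y)⁻¹ i j * (pd i (pd j F) y - ∑ k, christoffel G k i j y * pd k F y)

/-- The squared norm of the gradient, `G^{ij} ∂_i F ∂_j F`. -/
def coordGradNormSq (G : EuclideanSpace ℝ (Fin n) → Matrix (Fin n) (Fin n) ℝ)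
    (F : EuclideanSpace ℝ (Fin n) → ℝ) (y : EuclideanSpace ℝ (Fin n)) : ℝ :=
  ∑ i, ∑ j, (G y)⁻¹ i j * pd i F y * pd j F y

/-- The components `η^i = - G^{i0} / √G^{00}` of the outward unit normal of the hypersurface
`{y | y 0 = 0}` of the half-space `{y | 0 ≤ y 0}`. -/
def outwardNormal (G : EuclideanSpace ℝ (Fin n) → Matrix (Fin n) (Fin n) ℝ) (i : Fin n)
    (y : EuclideanSpace ℝ (Fin n)) : ℝ :=
  - (G y)⁻¹ i 0 / √((G y)⁻¹ 0 0)

/-- `- ⟨∇_{∂_i} ∂_j, η⟩`. On vectors tangent to `{y | y 0 = 0}` this is the second fundamental form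
`⟨∇_X η, Y⟩` with respect to the outward unit normal `η`. -/
def secondFundamental (G : EuclideanSpace ℝ (Fin n) → Matrix (Fin n) (Fin n) ℝ) (i j : Fin n)
    (y : EuclideanSpace ℝ (Fin n)) : ℝ :=
  - ∑ k, ∑ l, G y k l * christoffel G k i j y * outwardNormal G l y

/-- The mean curvature of `{y | y 0 = 0}`: the second fundamental form with respect to the outward
normal, traced with the induced metric (whose inverse is `G^{ij} - η^i η^j`) and divided by `n - 1`
(the unit sphere as the boundary of the flat unit ball has mean curvature `1`). -/
def coordMeanCurvature (G : EuclideanSpace ℝ (Fin n) → Matrix (Fin n) (Fin n) ℝ)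
    (y : EuclideanSpace ℝ (Fin n)) : ℝ :=
  (1 / ((n : ℝ) - 1)) * ∑ i, ∑ j,
    ((G y)⁻¹ i j - outwardNormal G i y * outwardNormal G j y) * secondFundamental G i j y

end Coordinates

/-! ### Riemannian manifolds with boundary -/

section Manifolds

variable {n : ℕ} [NeZero n] {M : Type*} [TopologicalSpace M]
  [ChartedSpace (EuclideanHalfSpace n) M] [IsManifold (𝓡∂ n) ∞ M]

variable (n M) in
/-- Smooth (up to the boundary) Riemannian metrics on the `n`-manifold with boundary `M`. -/
abbrev SmoothMetric :=
  Bundle.ContMDiffRiemannianMetric (𝓡∂ n) ∞ (EuclideanSpace ℝ (Fin n))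
    (fun x : M => TangentSpace (𝓡∂ n) x)

/-- The matrix `g(∂_i, ∂_j)` of `g` in the preferred chart at `x`, at the point with coordinates
`y`; here `∂_i` is the push-forward of the `i`-th basis vector under the inverse of the chart. -/
def gram (g : SmoothMetric n M) (x : M) (y : EuclideanSpace ℝ (Fin n)) :
    Matrix (Fin n) (Fin n) ℝ := fun i j =>
  g.inner ((extChartAt (𝓡∂ n) x).symm y)
    (mfderivWithin 𝓘(ℝ, EuclideanSpace ℝ (Fin n)) (𝓡∂ n) (extChartAt (𝓡∂ n) x).symm
      (range (𝓡∂ n)) y (EuclideanSpace.single i (1 : ℝ) : EuclideanSpace ℝ (Fin n)))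
    (mfderivWithin 𝓘(ℝ, EuclideanSpace ℝ (Fin n)) (𝓡∂ n) (extChartAt (𝓡∂ n) x).symm
      (range (𝓡∂ n)) y (EuclideanSpace.single j (1 : ℝ) : EuclideanSpace ℝ (Fin n)))

/-- The scalar curvature `s_g`. -/
def scalarCurvature (g : SmoothMetric n M) (x : M) : ℝ :=
  coordScalar (gram g x) (extChartAt (𝓡∂ n) x x)

/-- The Laplacian `Δ_g f = div ∇ f`. -/
def laplacian (g : SmoothMetric n M) (f : M → ℝ) (x : M) : ℝ :=
  coordLaplacian (gram g x) (f ∘ (extChartAt (𝓡∂ n) x).symm) (extChartAt (𝓡∂ n) x x)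

/-- `‖∇ f‖²` with respect to `g`. -/
def gradNormSq (g : SmoothMetric n M) (f : M → ℝ) (x : M) : ℝ :=
  coordGradNormSq (gram g x) (f ∘ (extChartAt (𝓡∂ n) x).symm) (extChartAt (𝓡∂ n) x x)

/-- The mean curvature `h_g` of `∂M`; meaningful at points `x` of `∂M`. -/
def boundaryMeanCurvature (g : SmoothMetric n M) (x : M) : ℝ :=
  coordMeanCurvature (gram g x) (extChartAt (𝓡∂ n) x x)

/-- The Riemannian volume measure `dv_g`. The measure `√(det g) dy` of each chart, transported to
`M`, is the restriction of `dv_g` to the domain of that chart; `dv_g` is the least measure that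
dominates all of these. -/
def volumeMeasure [MeasurableSpace M] (g : SmoothMetric n M) : Measure M :=
  ⨆ x : M, Measure.map (extChartAt (𝓡∂ n) x).symm
    ((volume.restrict (extChartAt (𝓡∂ n) x).target).withDensity
      fun y => ENNReal.ofReal √((gram g x y).det))

/-- `f` is an isoparametric function of `(M, g)`: smooth, not constant, with `‖∇ f‖² = b ∘ f` and
`Δ_g f = a ∘ f` for smooth functions `a`, `b` on the range of `f`, and locally constant on `∂M`. -/
structure IsIsoparametric (g : SmoothMetric n M) (f : M → ℝ) : Prop where
  smooth : ContMDiff (𝓡∂ n) 𝓘(ℝ, ℝ) ∞ f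
  nonconstant : ¬ ∃ c : ℝ, ∀ x, f x = c
  gradient : ∃ b : ℝ → ℝ, ContDiffOn ℝ ∞ b (range f) ∧ ∀ x, gradNormSq g f x = b (f x)
  laplace : ∃ a : ℝ → ℝ, ContDiffOn ℝ ∞ a (range f) ∧ ∀ x, laplacian g f x = a (f x)
  boundary : IsLocallyConstant (fun p : (𝓡∂ n).boundary M => f p)

/-- `h = φ g` pointwise. -/
def IsScaledBy (h g : SmoothMetric n M) (φ : M → ℝ) : Prop :=
  ∀ (x : M) (v w : TangentSpace (𝓡∂ n) x), h.inner x v w = φ x * g.inner x v w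

/-- The conformal class `[g]`: all metrics `φ g` with `φ` positive and smooth. -/
def conformalClass (g : SmoothMetric n M) : Set (SmoothMetric n M) :=
  {h | ∃ φ : M → ℝ, ContMDiff (𝓡∂ n) 𝓘(ℝ, ℝ) ∞ φ ∧ (∀ x, 0 < φ x) ∧ IsScaledBy h g φ}

/-- `[g]_f`: the metrics of `[g]` for which `f` is isoparametric. -/
def isoparametricClass (g : SmoothMetric n M) (f : M → ℝ) : Set (SmoothMetric n M) :=
  {h | h ∈ conformalClass g ∧ IsIsoparametric h f}

/-- `g` is scalar flat and `∂M` has constant mean curvature. -/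
def IsScalarFlatCMC (g : SmoothMetric n M) : Prop :=
  (∀ x, scalarCurvature g x = 0) ∧
    ∃ c : ℝ, ∀ x ∈ (𝓡∂ n).boundary M, boundaryMeanCurvature g x = c

end Manifolds

end BoundaryConformal

end

open BoundaryConformal

/-!
Two metrics `g₁` and `g₂ = φ g₁` of `[g]_f` share the isoparametric function `f`, and this alone
almost determines `φ` as a function of `f`: from `‖∇f‖²_{g_i} = b_i ∘ f` and `φ ‖∇f‖²_{g₂} =
‖∇f‖²_{g₁}` one gets `φ = (b₁ / b₂) ∘ f` wherever `∇f ≠ 0`. If both metrics are scalar flat, the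
conformal transformation law of the scalar curvature (`IsCoordMetric.coordScalar_conformal`) says
that `u = φ ^ ((n - 2) / 4)` is `g₁`-harmonic (`laplacian_rpow_eq_zero`). Writing `u = U ∘ f` turns
`Δ u = 0` into the ordinary differential equation `U'' b₁ + U' a₁ = 0` on the interior of `f(M) =
[m, R]`, and the theorem reduces to showing that `U` is constant. Neither a maximum principle nor an
integration by parts is needed.

The equation is singular at the endpoints, and the geometry enters through the critical levels of
`f`. Let `b` vanish at `c`. If `b'(c) = 0`, then `‖∇f‖ ≤ C |f - c|` near the level `c`, so that `f`
is locally constant along it, hence constant on the connected manifold `M`; thus zeros of `b` are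
simple (`derivWithin_ne_zero`), and since `b ≥ 0` they occur only at `m` and `R` (`b_pos`).
Differentiating `‖∇f‖² = b(f)` twice at a critical point shows that the Hessian `H` and the inverse
metric `A` satisfy `H A H = (b'(c) / 2) H`. So `(2 / b'(c)) A H` is idempotent and its trace is a
natural number `r`, that is, `a(c) = r b'(c) / 2` (`exists_nat_coordLaplacian`). If `r = 0` then `H
= 0`, and the once differentiated equation forces `f` to be constant nearby
(`eventually_eq_of_hessian_eq_zero`). As `a(c)` determines `r`, this would happen at all points of
the level, which is impossible as before, so `r ≥ 1` and `b'(m) ≤ 2 a(m)` when `b(m) = 0`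
(`derivWithin_le`). It follows also that no level set has interior points, so that regular points
are dense (`dense_preimage_Ioo`).

The boundary is connected, so `f` is constant on it and one of its two extrema, say the minimum `m`
(otherwise pass to `-f`), is attained at an interior point, where `∇f = 0` and so `b₁(m) = b₂(m) =
0`. Put `P = U'² b₁`. Since `b₁` and `b₂` have simple zeros at `m`, the function `U'` is bounded
near `m` and `P → 0` there. On the other hand `P' = U'² (b₁' - 2 a₁) ≤ K P` because `b₁'(m) ≤ 2
a₁(m)`, so `exp (-K t) P` is nonincreasing and `P` cannot tend to `0` unless it vanishes
(`eq_of_ode_of_simple_zeros`). Hence `U' = 0`, and `u` is constant on a dense set. The metrics are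
therefore homothetic, and the volume normalisation makes them equal.

All coordinate computations take place on relatively open subsets of the half-space, with one-sided
derivatives, so that they apply to interior and boundary points alike.
-/

namespace BoundaryConformal

open Filter Topology Asymptotics

/-! ### Partial derivatives in the half-space -/

section Coordinates

variable {n : ℕ} [NeZero n] {T : Set (EuclideanSpace ℝ (Fin n))}
  {F K : EuclideanSpace ℝ (Fin n) → ℝ} {y : EuclideanSpace ℝ (Fin n)}

/-- `T` is a relatively open subset of the closed half-space. -/
def IsHalfOpen (T : Set (EuclideanSpace ℝ (Fin n))) : Prop :=
  ∃ O, IsOpen O ∧ T = range (𝓡∂ n) ∩ O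

namespace IsHalfOpen

theorem subset_range (hT : IsHalfOpen T) : T ⊆ range (𝓡∂ n) := by
  obtain ⟨O, -, rfl⟩ := hT
  exact inter_subset_left

theorem mem_nhdsWithin (hT : IsHalfOpen T) (hy : y ∈ T) : T ∈ 𝓝[range (𝓡∂ n)] y := by
  obtain ⟨O, hO, rfl⟩ := hT
  exact inter_mem_nhdsWithin _ (hO.mem_nhds hy.2)

theorem nhdsWithin_eq (hT : IsHalfOpen T) (hy : y ∈ T) : 𝓝[T] y = 𝓝[range (𝓡∂ n)] y :=
  le_antisymm (nhdsWithin_mono _ hT.subset_range) (nhdsWithin_le_iff.2 (hT.mem_nhdsWithin hy))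

theorem fderivWithin_eq (hT : IsHalfOpen T) (hy : y ∈ T) :
    fderivWithin ℝ F T y = fderivWithin ℝ F (range (𝓡∂ n)) y := by
  obtain ⟨O, hO, rfl⟩ := hT
  exact fderivWithin_inter (hO.mem_nhds hy.2)

theorem uniqueDiffOn (hT : IsHalfOpen T) : UniqueDiffOn ℝ T := by
  obtain ⟨O, hO, rfl⟩ := hT
  exact (𝓡∂ n).uniqueDiffOn.inter hO

theorem differentiableWithinAt (hT : IsHalfOpen T) (hF : ContDiffOn ℝ ∞ F T) (hy : y ∈ T) :
    DifferentiableWithinAt ℝ F (range (𝓡∂ n)) y :=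
  ((hF.differentiableOn (by simp)) y hy).mono_of_mem_nhdsWithin (hT.mem_nhdsWithin hy)

theorem pd_contDiffOn (hT : IsHalfOpen T) (hF : ContDiffOn ℝ ∞ F T) (i : Fin n) :
    ContDiffOn ℝ ∞ (pd i F) T := by
  have h := (hF.fderivWithin hT.uniqueDiffOn (m := ∞) (by simp)).clm_apply
    (contDiffOn_const (c := EuclideanSpace.single i (1 : ℝ)))
  refine h.congr fun z hz => ?_
  rw [pd, hT.fderivWithin_eq hz]

theorem pd_congr (hT : IsHalfOpen T) (h : EqOn F K T) (hy : y ∈ T) (i : Fin n) :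
    pd i F y = pd i K y := by
  rw [pd, pd, ← hT.fderivWithin_eq hy, ← hT.fderivWithin_eq hy, fderivWithin_congr h (h hy)]

theorem inter_preimage (hT : IsHalfOpen T) (hF : ContinuousOn F T) {J : Set ℝ} (hJ : IsOpen J) :
    IsHalfOpen (T ∩ F ⁻¹' J) := by
  obtain ⟨O, hO, rfl⟩ := hT
  obtain ⟨V, hV, h⟩ := continuousOn_iff'.1 hF J hJ
  refine ⟨V ∩ O, hV.inter hO, ?_⟩
  rw [inter_comm, h]
  ext z
  simp only [mem_inter_iff]
  tauto

end IsHalfOpen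

theorem uniqueDiffWithinAt_of_mem (hy : y ∈ range (𝓡∂ n)) :
    UniqueDiffWithinAt ℝ (range (𝓡∂ n)) y := (𝓡∂ n).uniqueDiffOn y hy

theorem pd_add (hy : y ∈ range (𝓡∂ n)) (hF : DifferentiableWithinAt ℝ F (range (𝓡∂ n)) y)
    (hK : DifferentiableWithinAt ℝ K (range (𝓡∂ n)) y) (i : Fin n) :
    pd i (fun z => F z + K z) y = pd i F y + pd i K y := by
  simp only [pd]
  rw [fderivWithin_fun_add (uniqueDiffWithinAt_of_mem hy) hF hK]
  rfl

theorem pd_sub (hy : y ∈ range (𝓡∂ n)) (hF : DifferentiableWithinAt ℝ F (range (𝓡∂ n)) y)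
    (hK : DifferentiableWithinAt ℝ K (range (𝓡∂ n)) y) (i : Fin n) :
    pd i (fun z => F z - K z) y = pd i F y - pd i K y := by
  simp only [pd]
  rw [fderivWithin_fun_sub (uniqueDiffWithinAt_of_mem hy) hF hK]
  rfl

theorem pd_neg (hy : y ∈ range (𝓡∂ n)) (i : Fin n) :
    pd i (fun z => - F z) y = - pd i F y := by
  simp only [pd]
  rw [fderivWithin_fun_neg (uniqueDiffWithinAt_of_mem hy)]
  rfl

theorem pd_mul (hy : y ∈ range (𝓡∂ n)) (hF : DifferentiableWithinAt ℝ F (range (𝓡∂ n)) y)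
    (hK : DifferentiableWithinAt ℝ K (range (𝓡∂ n)) y) (i : Fin n) :
    pd i (fun z => F z * K z) y = F y * pd i K y + pd i F y * K y := by
  simp only [pd]
  rw [fderivWithin_fun_mul (uniqueDiffWithinAt_of_mem hy) hF hK]
  simp [mul_comm]

theorem pd_sum {ι : Type*} {s : Finset ι} {A : ι → EuclideanSpace ℝ (Fin n) → ℝ}
    (hy : y ∈ range (𝓡∂ n))
    (hA : ∀ a ∈ s, DifferentiableWithinAt ℝ (A a) (range (𝓡∂ n)) y) (i : Fin n) :
    pd i (fun z => ∑ a ∈ s, A a z) y = ∑ a ∈ s, pd i (A a) y := by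
  simp only [pd]
  rw [fderivWithin_fun_sum (uniqueDiffWithinAt_of_mem hy) hA]
  simp

theorem pd_const (c : ℝ) (i : Fin n) : pd i (fun _ => c) y = 0 := by
  simp [pd]

/-- The chain rule for an outer function on a set `J` of reals that need not be open, such as the
closed interval `f(M)`. -/
theorem pd_comp {J : Set ℝ} {V : ℝ → ℝ} (hT : IsHalfOpen T) (hF : ContDiffOn ℝ ∞ F T)
    (hy : y ∈ T) (hFJ : MapsTo F T J)
    (hV : DifferentiableWithinAt ℝ V J (F y)) (i : Fin n) :
    pd i (fun z => V (F z)) y = derivWithin V J (F y) * pd i F y := by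
  have h1 := (hF.differentiableOn (by simp)) y hy
  have h := hV.hasDerivWithinAt.hasFDerivWithinAt.comp y h1.hasFDerivWithinAt hFJ
  simp only [pd]
  rw [← hT.fderivWithin_eq hy, ← hT.fderivWithin_eq hy]
  have h2 := h.fderivWithin (hT.uniqueDiffOn y hy)
  change fderivWithin ℝ (V ∘ F) T y _ = _
  rw [h2]
  simp [mul_comm]

/-- `Δ (V ∘ F) = V'(F) Δ F + V''(F) ‖∇F‖²`. -/
theorem coordLaplacian_comp {J : Set ℝ} {V : ℝ → ℝ}
    {G : EuclideanSpace ℝ (Fin n) → Matrix (Fin n) (Fin n) ℝ} (hT : IsHalfOpen T)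
    (hF : ContDiffOn ℝ ∞ F T) (hy : y ∈ T) (hJ : UniqueDiffOn ℝ J) (hFJ : MapsTo F T J)
    (hV : ContDiffOn ℝ ∞ V J) :
    coordLaplacian G (fun z => V (F z)) y = derivWithin V J (F y) * coordLaplacian G F y
      + derivWithin (derivWithin V J) J (F y) * coordGradNormSq G F y := by
  have h := fun z (hz : z ∈ T) i =>
    pd_comp hT hF hz hFJ (hV.differentiableOn (by simp) _ (hFJ hz)) i
  have hV' : ContDiffOn ℝ ∞ (derivWithin V J) J := hV.derivWithin hJ (by simp)
  have h2 : ∀ i j, pd i (pd j (fun z => V (F z))) y = derivWithin V J (F y) * pd i (pd j F) y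
      + derivWithin (derivWithin V J) J (F y) * pd i F y * pd j F y := by
    intro i j
    rw [hT.pd_congr (K := fun z => derivWithin V J (F z) * pd j F z) (fun z hz => h z hz j) hy,
      pd_mul (F := fun z => derivWithin V J (F z)) (hT.subset_range hy)
        (hT.differentiableWithinAt (hV'.comp hF hFJ) hy)
        (hT.differentiableWithinAt (hT.pd_contDiffOn hF j) hy),
      pd_comp hT hF hy hFJ (hV'.differentiableOn (by simp) _ (hFJ hy))]
  simp only [coordLaplacian, coordGradNormSq, h y hy, h2, Finset.mul_sum]
  rw [← Finset.sum_add_distrib]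
  refine Finset.sum_congr rfl fun i _ => ?_
  rw [← Finset.sum_add_distrib]
  refine Finset.sum_congr rfl fun j _ => ?_
  rw [show ∑ k, christoffel G k i j y * (derivWithin V J (F y) * pd k F y)
    = derivWithin V J (F y) * ∑ k, christoffel G k i j y * pd k F y by
      rw [Finset.mul_sum]; exact Finset.sum_congr rfl fun k _ => by ring]
  ring

end Coordinates

/-! ### Riemannian metrics in coordinates -/

theorem contDiffOn_det {V ι : Type*} [NormedAddCommGroup V] [NormedSpace ℝ V] [Fintype ι]
    [DecidableEq ι] {T : Set V} {N : V → Matrix ι ι ℝ}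
    (hN : ∀ i j, ContDiffOn ℝ ∞ (fun z => N z i j) T) :
    ContDiffOn ℝ ∞ (fun z => (N z).det) T := by
  simp only [Matrix.det_apply]
  exact ContDiffOn.sum fun σ _ => (contDiffOn_prod fun i _ => hN _ _).const_smul _

section Metric

variable {n : ℕ} [NeZero n] {T : Set (EuclideanSpace ℝ (Fin n))}
  {G G' : EuclideanSpace ℝ (Fin n) → Matrix (Fin n) (Fin n) ℝ}
  {F φ : EuclideanSpace ℝ (Fin n) → ℝ} {y : EuclideanSpace ℝ (Fin n)}

/-- `G` is the matrix of a smooth Riemannian metric on the relatively open subset `T` of the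
half-space. -/
structure IsCoordMetric (G : EuclideanSpace ℝ (Fin n) → Matrix (Fin n) (Fin n) ℝ)
    (T : Set (EuclideanSpace ℝ (Fin n))) : Prop where
  isHalfOpen : IsHalfOpen T
  smooth : ∀ i j, ContDiffOn ℝ ∞ (fun z => G z i j) T
  posDef : ∀ z ∈ T, (G z).PosDef

namespace IsCoordMetric

theorem symm (hG : IsCoordMetric G T) (hy : y ∈ T) (i j : Fin n) : G y i j = G y j i := by
  simpa using (hG.posDef y hy).isHermitian.apply j i

theorem inv_symm (hG : IsCoordMetric G T) (hy : y ∈ T) (i j : Fin n) :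
    (G y)⁻¹ i j = (G y)⁻¹ j i := by
  simpa using (hG.posDef y hy).inv.isHermitian.apply j i

theorem det_ne_zero (hG : IsCoordMetric G T) (hy : y ∈ T) : (G y).det ≠ 0 :=
  (hG.posDef y hy).det_pos.ne'

theorem mul_inv (hG : IsCoordMetric G T) (hy : y ∈ T) : G y * (G y)⁻¹ = 1 :=
  Matrix.mul_nonsing_inv _ (hG.det_ne_zero hy).isUnit

theorem inv_mul (hG : IsCoordMetric G T) (hy : y ∈ T) : (G y)⁻¹ * G y = 1 :=
  Matrix.nonsing_inv_mul _ (hG.det_ne_zero hy).isUnit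

theorem sum_inv_mul (hG : IsCoordMetric G T) (hy : y ∈ T) (i j : Fin n) :
    ∑ k, (G y)⁻¹ i k * G y k j = if i = j then 1 else 0 := by
  rw [← Matrix.mul_apply, hG.inv_mul hy, Matrix.one_apply]

theorem inv_of_eq_smul (hG : IsCoordMetric G T) (hy : y ∈ T) {c : ℝ} (hc : c ≠ 0)
    (h : G' y = c • G y) : (G' y)⁻¹ = c⁻¹ • (G y)⁻¹ := by
  refine Matrix.inv_eq_left_inv ?_
  rw [h, Matrix.smul_mul, Matrix.mul_smul, smul_smul, inv_mul_cancel₀ hc, one_smul, hG.inv_mul hy]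

end IsCoordMetric

namespace IsCoordMetric

theorem inv_contDiffOn (hG : IsCoordMetric G T) (i j : Fin n) :
    ContDiffOn ℝ ∞ (fun z => (G z)⁻¹ i j) T := by
  have h : ∀ z, (G z)⁻¹ i j = (G z).det⁻¹ * ((G z).updateRow j (Pi.single i 1)).det := by
    intro z
    rw [Matrix.inv_def, Matrix.smul_apply, Matrix.adjugate_apply, Ring.inverse_eq_inv', smul_eq_mul]
  simp only [h]
  refine ((contDiffOn_det hG.smooth).inv fun z hz => hG.det_ne_zero hz).mul
    (contDiffOn_det fun a b => ?_)
  by_cases ha : a = j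
  · subst ha
    simpa using contDiffOn_const
  · simpa [Matrix.updateRow_ne ha] using hG.smooth a b

theorem christoffel_contDiffOn (hG : IsCoordMetric G T) (k i j : Fin n) :
    ContDiffOn ℝ ∞ (christoffel G k i j) T := by
  have hpd := fun a b c => hG.isHalfOpen.pd_contDiffOn (hG.smooth a b) c
  unfold christoffel
  exact contDiffOn_const.mul (ContDiffOn.sum fun l _ =>
    (hG.inv_contDiffOn k l).mul (((hpd _ _ _).add (hpd _ _ _)).sub (hpd _ _ _)))

theorem pd_symm (hG : IsCoordMetric G T) (hy : y ∈ T) (k i j : Fin n) :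
    pd k (fun z => G z i j) y = pd k (fun z => G z j i) y :=
  hG.isHalfOpen.pd_congr (fun _ hz => hG.symm hz i j) hy k

theorem christoffel_symm (hG : IsCoordMetric G T) (hy : y ∈ T) (k i j : Fin n) :
    christoffel G k i j y = christoffel G k j i y := by
  unfold christoffel
  congr 1
  refine Finset.sum_congr rfl fun l _ => ?_
  rw [hG.pd_symm hy l i j]
  ring

/-- The Christoffel symbols with lowered index, `½ (∂_i G_{jm} + ∂_j G_{im} - ∂_m G_{ij})`. -/
theorem sum_mul_christoffel (hG : IsCoordMetric G T) (hy : y ∈ T) (m i j : Fin n) :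
    ∑ l, G y m l * christoffel G l i j y = (1 / 2) *
      (pd i (fun z => G z j m) y + pd j (fun z => G z i m) y - pd m (fun z => G z i j) y) := by
  set X : Fin n → ℝ := fun l =>
    pd i (fun z => G z j l) y + pd j (fun z => G z i l) y - pd l (fun z => G z i j) y with hX
  calc ∑ l, G y m l * christoffel G l i j y
      = (1 / 2) * (G y).mulVec ((G y)⁻¹.mulVec X) m := by
        simp only [Matrix.mulVec, dotProduct, christoffel, Finset.mul_sum]
        exact Finset.sum_congr rfl fun l _ => Finset.sum_congr rfl fun p _ => by ring
    _ = _ := by rw [Matrix.mulVec_mulVec, hG.mul_inv hy, Matrix.one_mulVec]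

/-- The Levi-Civita connection is metric. -/
theorem pd_eq_sum_christoffel (hG : IsCoordMetric G T) (hy : y ∈ T) (k i j : Fin n) :
    pd k (fun z => G z i j) y = ∑ l, G y i l * christoffel G l k j y
      + ∑ l, G y j l * christoffel G l k i y := by
  rw [hG.sum_mul_christoffel hy, hG.sum_mul_christoffel hy, hG.pd_symm hy k j i,
    hG.pd_symm hy i k j]
  ring

end IsCoordMetric

/-- The components `φ^k = G^{kl} ∂_l φ` of the gradient. -/
noncomputable def coordGrad (G : EuclideanSpace ℝ (Fin n) → Matrix (Fin n) (Fin n) ℝ)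
    (φ : EuclideanSpace ℝ (Fin n) → ℝ) (k : Fin n) (y : EuclideanSpace ℝ (Fin n)) : ℝ :=
  ∑ l, (G y)⁻¹ k l * pd l φ y

namespace IsCoordMetric

theorem coordGrad_contDiffOn (hG : IsCoordMetric G T) (hφ : ContDiffOn ℝ ∞ φ T) (k : Fin n) :
    ContDiffOn ℝ ∞ (coordGrad G φ k) T := by
  unfold coordGrad
  exact ContDiffOn.sum fun l _ =>
    (hG.inv_contDiffOn k l).mul (hG.isHalfOpen.pd_contDiffOn hφ l)

theorem sum_mul_coordGrad (hG : IsCoordMetric G T) (hy : y ∈ T) (m : Fin n) :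
    ∑ k, G y m k * coordGrad G φ k y = pd m φ y := by
  calc ∑ k, G y m k * coordGrad G φ k y
      = (G y).mulVec ((G y)⁻¹.mulVec fun l => pd l φ y) m := by
        simp only [Matrix.mulVec, dotProduct, coordGrad]
    _ = _ := by rw [Matrix.mulVec_mulVec, hG.mul_inv hy, Matrix.one_mulVec]

theorem sum_coordGrad_mul_pd :
    ∑ k, coordGrad G φ k y * pd k φ y = coordGradNormSq G φ y := by
  simp only [coordGradNormSq, coordGrad, Finset.sum_mul]
  exact Finset.sum_congr rfl fun i _ => Finset.sum_congr rfl fun j _ => by ring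

/-- The Laplacian as the divergence of the gradient. -/
theorem coordLaplacian_eq_div (hG : IsCoordMetric G T) (hφ : ContDiffOn ℝ ∞ φ T) (hy : y ∈ T) :
    coordLaplacian G φ y = ∑ k, pd k (coordGrad G φ k) y
      + ∑ l, (∑ k, christoffel G k k l y) * coordGrad G φ l y := by
  have hT := hG.isHalfOpen
  have hr := hT.subset_range hy
  have h2 : ∀ k l, pd k (pd l φ) y = ∑ m, (G y l m * pd k (coordGrad G φ m) y
      + pd k (fun z => G z l m) y * coordGrad G φ m y) := by
    intro k l
    rw [hT.pd_congr (K := fun z => ∑ m, G z l m * coordGrad G φ m z)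
      (fun z hz => (hG.sum_mul_coordGrad hz l).symm) hy, pd_sum hr]
    · refine Finset.sum_congr rfl fun m _ => ?_
      exact pd_mul hr (hT.differentiableWithinAt (hG.smooth l m) hy)
        (hT.differentiableWithinAt (hG.coordGrad_contDiffOn hφ m) hy) k
    · exact fun m _ => hT.differentiableWithinAt
        ((hG.smooth l m).mul (hG.coordGrad_contDiffOn hφ m)) hy
  have h3 : ∀ k l, pd k (pd l φ) y - ∑ p, christoffel G p k l y * pd p φ y
      = ∑ m, G y l m * (pd k (coordGrad G φ m) y
        + ∑ q, christoffel G m k q y * coordGrad G φ q y) := by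
    intro k l
    have e1 : ∑ p, christoffel G p k l y * pd p φ y
        = ∑ m, (∑ p, G y m p * christoffel G p k l y) * coordGrad G φ m y := by
      simp only [← hG.sum_mul_coordGrad hy, Finset.mul_sum, Finset.sum_mul]
      rw [Finset.sum_comm]
      exact Finset.sum_congr rfl fun a _ => Finset.sum_congr rfl fun b _ => by
        rw [hG.symm hy a b]; ring
    have e2 : ∑ m, G y l m * ∑ q, christoffel G m k q y * coordGrad G φ q y
        = ∑ m, (∑ p, G y l p * christoffel G p k m y) * coordGrad G φ m y := by
      simp only [Finset.mul_sum, Finset.sum_mul]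
      rw [Finset.sum_comm]
      exact Finset.sum_congr rfl fun a _ => Finset.sum_congr rfl fun b _ => by ring
    simp only [mul_add, Finset.sum_add_distrib]
    rw [e1, e2, h2, Finset.sum_add_distrib, add_sub_assoc, ← Finset.sum_sub_distrib]
    congr 1
    refine Finset.sum_congr rfl fun m _ => ?_
    rw [hG.pd_eq_sum_christoffel hy k l m]
    ring
  have h4 : ∀ k m, ∑ l, (G y)⁻¹ k l * G y l m = if k = m then 1 else 0 :=
    fun k m => hG.sum_inv_mul hy k m
  calc coordLaplacian G φ y
      = ∑ k, ∑ l, (G y)⁻¹ k l * ∑ m, G y l m * (pd k (coordGrad G φ m) y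
        + ∑ q, christoffel G m k q y * coordGrad G φ q y) := by
        simp only [coordLaplacian, h3]
    _ = ∑ k, ∑ m, (∑ l, (G y)⁻¹ k l * G y l m) * (pd k (coordGrad G φ m) y
        + ∑ q, christoffel G m k q y * coordGrad G φ q y) := by
        refine Finset.sum_congr rfl fun k _ => ?_
        simp only [Finset.mul_sum, Finset.sum_mul]
        rw [Finset.sum_comm]
        exact Finset.sum_congr rfl fun a _ => Finset.sum_congr rfl fun b _ => by ring
    _ = ∑ k, (pd k (coordGrad G φ k) y + ∑ q, christoffel G k k q y * coordGrad G φ q y) := by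
        simp only [h4, ite_mul, one_mul, zero_mul, Finset.sum_ite_eq, Finset.mem_univ, if_true]
    _ = _ := by
        rw [Finset.sum_add_distrib]
        congr 1
        simp only [Finset.sum_mul]
        exact Finset.sum_comm

end IsCoordMetric

end Metric

/-! ### Conformal change of the scalar curvature -/

section Conformal

variable {n : ℕ} [NeZero n] {T : Set (EuclideanSpace ℝ (Fin n))}
  {G G' : EuclideanSpace ℝ (Fin n) → Matrix (Fin n) (Fin n) ℝ}
  {F φ : EuclideanSpace ℝ (Fin n) → ℝ} {y : EuclideanSpace ℝ (Fin n)}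

/-- The change of the Christoffel symbols when the metric `G` is multiplied by `exp (2 φ)`. -/
noncomputable def conformalDiff (G : EuclideanSpace ℝ (Fin n) → Matrix (Fin n) (Fin n) ℝ)
    (φ : EuclideanSpace ℝ (Fin n) → ℝ) (k i j : Fin n) (y : EuclideanSpace ℝ (Fin n)) : ℝ :=
  (if k = i then 1 else 0) * pd j φ y + (if k = j then 1 else 0) * pd i φ y
    - G y i j * coordGrad G φ k y

namespace IsCoordMetric

theorem conformalDiff_contDiffOn (hG : IsCoordMetric G T) (hφ : ContDiffOn ℝ ∞ φ T)
    (k i j : Fin n) : ContDiffOn ℝ ∞ (conformalDiff G φ k i j) T := by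
  have hpd := fun a => hG.isHalfOpen.pd_contDiffOn hφ a
  unfold conformalDiff
  exact ((contDiffOn_const.mul (hpd j)).add (contDiffOn_const.mul (hpd i))).sub
    ((hG.smooth i j).mul (hG.coordGrad_contDiffOn hφ k))

theorem christoffel_conformal (hG : IsCoordMetric G T) (hφ : ContDiffOn ℝ ∞ φ T)
    (hG' : ∀ z ∈ T, G' z = Real.exp (2 * φ z) • G z) (hy : y ∈ T) (k i j : Fin n) :
    christoffel G' k i j y = christoffel G k i j y + conformalDiff G φ k i j y := by
  have hT := hG.isHalfOpen
  have hr := hT.subset_range hy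
  have hexp : ContDiffOn ℝ ∞ (fun z => Real.exp (2 * φ z)) T := (contDiffOn_const.mul hφ).exp
  have hpe : ∀ a, pd a (fun z => Real.exp (2 * φ z)) y = Real.exp (2 * φ y) * (2 * pd a φ y) := by
    intro a
    have h1 : HasDerivAt (fun t : ℝ => Real.exp (2 * t)) (Real.exp (2 * φ y) * (2 * 1)) (φ y) :=
      ((hasDerivAt_id (φ y)).const_mul 2).exp
    have h2 := pd_comp (V := fun t => Real.exp (2 * t)) (J := univ) hT hφ hy (mapsTo_univ _ _)
      h1.differentiableAt.differentiableWithinAt a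
    rw [h2, derivWithin_univ, h1.deriv]
    ring
  have hpd : ∀ a b c, pd a (fun z => G' z b c) y = Real.exp (2 * φ y) *
      (pd a (fun z => G z b c) y + 2 * pd a φ y * G y b c) := by
    intro a b c
    rw [hT.pd_congr (K := fun z => Real.exp (2 * φ z) * G z b c)
        (fun z hz => by simp [hG' z hz]) hy,
      pd_mul hr (hT.differentiableWithinAt hexp hy) (hT.differentiableWithinAt (hG.smooth b c) hy),
      hpe]
    ring
  have hinv : ∀ a b, (G' y)⁻¹ a b = (Real.exp (2 * φ y))⁻¹ * (G y)⁻¹ a b := by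
    intro a b
    simp [hG.inv_of_eq_smul hy (Real.exp_ne_zero _) (hG' y hy)]
  have he : (Real.exp (2 * φ y))⁻¹ * Real.exp (2 * φ y) = 1 :=
    inv_mul_cancel₀ (Real.exp_ne_zero _)
  have s1 : ∀ b, ∑ l, (G y)⁻¹ k l * G y l b = if k = b then 1 else 0 := hG.sum_inv_mul hy k
  have key : ∀ l, (G' y)⁻¹ k l * (pd i (fun z => G' z j l) y + pd j (fun z => G' z i l) y
      - pd l (fun z => G' z i j) y)
      = (G y)⁻¹ k l * (pd i (fun z => G z j l) y + pd j (fun z => G z i l) y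
      - pd l (fun z => G z i j) y) + (2 * pd i φ y * ((G y)⁻¹ k l * G y l j)
      + 2 * pd j φ y * ((G y)⁻¹ k l * G y l i) - 2 * G y i j * ((G y)⁻¹ k l * pd l φ y)) := by
    intro l
    rw [hinv, hpd, hpd, hpd, hG.symm hy l j, hG.symm hy l i]
    linear_combination ((G y)⁻¹ k l * (pd i (fun z => G z j l) y + 2 * pd i φ y * G y j l
      + (pd j (fun z => G z i l) y + 2 * pd j φ y * G y i l)
      - (pd l (fun z => G z i j) y + 2 * pd l φ y * G y i j))) * he
  simp only [christoffel, key]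
  rw [Finset.sum_add_distrib, Finset.sum_sub_distrib, Finset.sum_add_distrib, ← Finset.mul_sum,
    ← Finset.mul_sum, ← Finset.mul_sum, s1, s1, conformalDiff, coordGrad]
  ring

theorem sum_conformalDiff (hG : IsCoordMetric G T) (hy : y ∈ T) (l : Fin n) :
    ∑ k, conformalDiff G φ k k l y = n * pd l φ y := by
  simp only [conformalDiff, if_true, Finset.sum_sub_distrib, Finset.sum_add_distrib, ite_mul,
    one_mul, zero_mul, Finset.sum_ite_eq', Finset.mem_univ, Finset.sum_const, Finset.card_univ,
    Fintype.card_fin, nsmul_eq_mul]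
  rw [Finset.sum_congr rfl fun k _ => by rw [hG.symm hy k l], hG.sum_mul_coordGrad hy]
  ring

theorem conformalDiff_symm (hG : IsCoordMetric G T) (hy : y ∈ T) (k i j : Fin n) :
    conformalDiff G φ k i j y = conformalDiff G φ k j i y := by
  simp only [conformalDiff, hG.symm hy i j]
  ring

/-- The change of the Ricci tensor when `G` is multiplied by `exp (2 φ)`, with the Hessian of `φ`
written out in terms of `∂_i ∂_j φ`, `∂_j ∂_i φ` and Christoffel symbols. -/
theorem ricci_conformal (hG : IsCoordMetric G T) (hφ : ContDiffOn ℝ ∞ φ T)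
    (hG' : ∀ z ∈ T, G' z = Real.exp (2 * φ z) • G z) (hy : y ∈ T) (i j : Fin n) :
    ricci G' i j y = ricci G i j y
      + (pd i (pd j φ) y + pd j (pd i φ) y - n * pd j (pd i φ) y
        + (n - 2) * ∑ l, christoffel G l i j y * pd l φ y
        + (n - 2) * (pd i φ y * pd j φ y)
        - G y i j * (coordLaplacian G φ y + (n - 2) * coordGradNormSq G φ y)) := by
  have hT := hG.isHalfOpen
  have hr := hT.subset_range hy
  set Γ : Fin n → Fin n → Fin n → ℝ := fun k i j => christoffel G k i j y with hΓ
  set C : Fin n → Fin n → Fin n → ℝ := fun k i j => conformalDiff G φ k i j y with hC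
  have hpd : ∀ a k b c, pd a (christoffel G' k b c) y
      = pd a (christoffel G k b c) y + pd a (conformalDiff G φ k b c) y := by
    intro a k b c
    rw [hT.pd_congr (fun z hz => hG.christoffel_conformal hφ hG' hz k b c) hy,
      pd_add hr (hT.differentiableWithinAt (hG.christoffel_contDiffOn k b c) hy)
        (hT.differentiableWithinAt (hG.conformalDiff_contDiffOn hφ k b c) hy)]
  have hΓ' : ∀ k b c, christoffel G' k b c y = Γ k b c + C k b c :=
    fun k b c => hG.christoffel_conformal hφ hG' hy k b c
  have hN : ∑ k, coordGrad G φ k y * pd k φ y = coordGradNormSq G φ y := sum_coordGrad_mul_pd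
  have hgrad : ∀ m, ∑ k, G y m k * coordGrad G φ k y = pd m φ y := hG.sum_mul_coordGrad hy
  have hΓs : ∀ k a b, Γ k a b = Γ k b a := fun k a b => hG.christoffel_symm hy k a b
  have hCs : ∀ k a b, C k a b = C k b a := fun k a b => hG.conformalDiff_symm hy k a b
  have hCt : ∀ l, ∑ k, C k k l = n * pd l φ y := hG.sum_conformalDiff hy
  -- The contractions of the difference tensor `C` with one and with two of its indices.
  have hc1 : ∀ (X : Fin n → ℝ) a b, ∑ l, X l * C l a b
      = X a * pd b φ y + X b * pd a φ y - G y a b * ∑ l, X l * coordGrad G φ l y := by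
    intro X a b
    simp only [hC, conformalDiff, mul_sub, mul_add, Finset.sum_sub_distrib, Finset.sum_add_distrib,
      ite_mul, mul_ite, one_mul, zero_mul, mul_zero, Finset.sum_ite_eq', Finset.mem_univ, if_true,
      Finset.mul_sum]
    congr 1
    exact Finset.sum_congr rfl fun l _ => by ring
  have hc2 : ∀ (X : Fin n → Fin n → ℝ) a, ∑ k, ∑ l, X k l * C l a k
      = ∑ k, X k a * pd k φ y + (∑ k, X k k) * pd a φ y
        - ∑ k, G y a k * ∑ l, X k l * coordGrad G φ l y := by
    intro X a
    simp only [hc1, Finset.sum_sub_distrib, Finset.sum_add_distrib, Finset.sum_mul]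
  set t : Fin n → ℝ := fun l => ∑ k, Γ k k l with ht
  have S1 : ∑ k, pd k (conformalDiff G φ k i j) y = pd i (pd j φ) y + pd j (pd i φ) y
      - ∑ k, pd k (fun z => G z i j) y * coordGrad G φ k y
      - G y i j * ∑ k, pd k (coordGrad G φ k) y := by
    have h : ∀ k, pd k (conformalDiff G φ k i j) y
        = (if k = i then 1 else 0) * pd k (pd j φ) y + (if k = j then 1 else 0) * pd k (pd i φ) y
          - (G y i j * pd k (coordGrad G φ k) y
            + pd k (fun z => G z i j) y * coordGrad G φ k y) := by
      intro k
      have d1 := fun a => hT.differentiableWithinAt (hT.pd_contDiffOn hφ a) hy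
      have d2 := hT.differentiableWithinAt (hG.smooth i j) hy
      have d3 := hT.differentiableWithinAt (hG.coordGrad_contDiffOn hφ k) hy
      have m1 : DifferentiableWithinAt ℝ (fun z => (if k = i then (1 : ℝ) else 0) * pd j φ z)
          (range (𝓡∂ n)) y := (differentiableWithinAt_const _).mul (d1 j)
      have m2 : DifferentiableWithinAt ℝ (fun z => (if k = j then (1 : ℝ) else 0) * pd i φ z)
          (range (𝓡∂ n)) y := (differentiableWithinAt_const _).mul (d1 i)
      have e1 := pd_sub hr (m1.fun_add m2) (d2.fun_mul d3) k
      rw [pd_add hr m1 m2, pd_mul hr (differentiableWithinAt_const _) (d1 j),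
        pd_mul hr (differentiableWithinAt_const _) (d1 i), pd_mul hr d2 d3, pd_const,
        pd_const] at e1
      refine e1.trans ?_
      ring
    simp only [h, Finset.sum_sub_distrib, Finset.sum_add_distrib, ite_mul, one_mul, zero_mul,
      Finset.sum_ite_eq', Finset.mem_univ, if_true, ← Finset.mul_sum]
    ring
  have S2 : ∑ k, pd j (conformalDiff G φ k i k) y = n * pd j (pd i φ) y := by
    rw [← pd_sum hr fun k _ => hT.differentiableWithinAt (hG.conformalDiff_contDiffOn hφ k i k) hy,
      hT.pd_congr (K := fun z => n * pd i φ z) (fun z hz => ?_) hy,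
      pd_mul hr (differentiableWithinAt_const _)
        (hT.differentiableWithinAt (hT.pd_contDiffOn hφ i) hy), pd_const]
    · ring
    · refine Eq.trans ?_ (hG.sum_conformalDiff hz i)
      exact Finset.sum_congr rfl fun k _ => hG.conformalDiff_symm hz k i k
  have S3 : ∑ k, ∑ l, Γ k k l * C l i j = t i * pd j φ y + t j * pd i φ y
      - G y i j * ∑ l, t l * coordGrad G φ l y := by
    rw [Finset.sum_comm, ← hc1]
    simp only [ht, Finset.sum_mul]
  have S4 : ∑ k, ∑ l, C k k l * Γ l i j = n * ∑ l, Γ l i j * pd l φ y := by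
    rw [Finset.sum_comm]
    simp only [← Finset.sum_mul, hCt, Finset.mul_sum]
    exact Finset.sum_congr rfl fun l _ => by ring
  have S5 : ∑ k, ∑ l, C k k l * C l i j = n * (2 * (pd i φ y * pd j φ y)
      - G y i j * coordGradNormSq G φ y) := by
    rw [Finset.sum_comm]
    simp only [← Finset.sum_mul, hCt]
    rw [hc1 (fun l => n * pd l φ y) i j, ← hN]
    have : ∑ l, n * pd l φ y * coordGrad G φ l y
        = n * ∑ l, coordGrad G φ l y * pd l φ y := by
      rw [Finset.mul_sum]
      exact Finset.sum_congr rfl fun l _ => by ring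
    rw [this]
    ring
  have S6 : ∑ k, ∑ l, Γ k j l * C l i k = ∑ l, Γ l i j * pd l φ y + t j * pd i φ y
      - ∑ k, G y i k * ∑ l, Γ k j l * coordGrad G φ l y := by
    rw [hc2 (fun k l => Γ k j l)]
    simp only [ht, hΓs _ j]
  have S7 : ∑ k, ∑ l, C k j l * Γ l i k = ∑ l, Γ l i j * pd l φ y + t i * pd j φ y
      - ∑ k, G y j k * ∑ l, Γ k i l * coordGrad G φ l y := by
    rw [Finset.sum_comm]
    simp only [mul_comm (C _ _ _)]
    rw [hc2 (fun k l => Γ k i l)]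
    simp only [ht]
    rw [Finset.sum_congr rfl fun k _ => hΓs k i k]
  have S8 : ∑ k, ∑ l, C k j l * C l i k = (n + 2) * (pd i φ y * pd j φ y)
      - 2 * (G y i j * coordGradNormSq G φ y) := by
    rw [hc2 (fun k l => C k j l)]
    have h1 : ∑ k, C k j i * pd k φ y = 2 * (pd i φ y * pd j φ y)
        - G y i j * coordGradNormSq G φ y := by
      simp only [mul_comm (C _ _ _)]
      rw [hc1 (fun k => pd k φ y), ← hN, hG.symm hy j i]
      simp only [mul_comm (coordGrad _ _ _ _)]
      ring
    have h2 : ∑ k, C k j k = n * pd j φ y := by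
      rw [← hCt]
      exact Finset.sum_congr rfl fun k _ => hCs k j k
    have h3 : ∑ k, G y i k * ∑ l, C k j l * coordGrad G φ l y
        = G y i j * coordGradNormSq G φ y := by
      calc ∑ k, G y i k * ∑ l, C k j l * coordGrad G φ l y
          = ∑ l, (∑ k, G y i k * C k j l) * coordGrad G φ l y := by
            simp only [Finset.mul_sum, Finset.sum_mul]
            rw [Finset.sum_comm]
            exact Finset.sum_congr rfl fun a _ => Finset.sum_congr rfl fun b _ => by ring
        _ = ∑ l, (G y i j * (coordGrad G φ l y * pd l φ y)
              + (G y i l * coordGrad G φ l y) * pd j φ y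
              - (G y j l * coordGrad G φ l y) * pd i φ y) := by
            refine Finset.sum_congr rfl fun l _ => ?_
            rw [hc1 (fun k => G y i k), hgrad]
            ring
        _ = _ := by
            rw [Finset.sum_sub_distrib, Finset.sum_add_distrib, ← Finset.mul_sum, ← Finset.sum_mul,
              ← Finset.sum_mul, hgrad, hgrad, hN]
            ring
    rw [h1, h2, h3]
    ring
  -- Metricity cancels the derivatives of `G` against the contractions of `Γ` with the gradient.
  have hcompat : ∑ k, pd k (fun z => G z i j) y * coordGrad G φ k y
      = ∑ k, G y i k * ∑ l, Γ k j l * coordGrad G φ l y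
        + ∑ k, G y j k * ∑ l, Γ k i l * coordGrad G φ l y := by
    have h : ∀ a b, ∑ k, G y a k * ∑ l, Γ k b l * coordGrad G φ l y
        = ∑ k, (∑ l, G y a l * Γ l k b) * coordGrad G φ k y := by
      intro a b
      simp only [Finset.mul_sum, Finset.sum_mul]
      rw [Finset.sum_comm]
      exact Finset.sum_congr rfl fun p _ => Finset.sum_congr rfl fun q _ => by
        rw [hΓs q b p]; ring
    rw [h, h, ← Finset.sum_add_distrib]
    refine Finset.sum_congr rfl fun k _ => ?_
    rw [hG.pd_eq_sum_christoffel hy k i j, add_mul]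
  have hdiv : coordLaplacian G φ y = ∑ k, pd k (coordGrad G φ k) y
      + ∑ l, t l * coordGrad G φ l y := hG.coordLaplacian_eq_div hφ hy
  have hexpand : ricci G' i j y = ricci G i j y + (∑ k, pd k (conformalDiff G φ k i j) y
      - ∑ k, pd j (conformalDiff G φ k i k) y + ∑ k, ∑ l, Γ k k l * C l i j
      + ∑ k, ∑ l, C k k l * Γ l i j + ∑ k, ∑ l, C k k l * C l i j
      - ∑ k, ∑ l, Γ k j l * C l i k - ∑ k, ∑ l, C k j l * Γ l i k
      - ∑ k, ∑ l, C k j l * C l i k) := by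
    simp only [ricci, hpd, hΓ', ← Finset.sum_add_distrib, ← Finset.sum_sub_distrib]
    refine Finset.sum_congr rfl fun k _ => ?_
    have : ∀ l, (Γ k k l + C k k l) * (Γ l i j + C l i j)
        - (Γ k j l + C k j l) * (Γ l i k + C l i k)
        = (christoffel G k k l y * christoffel G l i j y
          - christoffel G k j l y * christoffel G l i k y)
        + (Γ k k l * C l i j + C k k l * Γ l i j + C k k l * C l i j
          - Γ k j l * C l i k - C k j l * Γ l i k - C k j l * C l i k) := fun l => by
      simp only [hΓ]; ring
    simp only [this, Finset.sum_add_distrib, Finset.sum_sub_distrib]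
    ring
  rw [hexpand, S1, S2, S3, S4, S5, S6, S7, S8, hdiv, hcompat]
  simp only [hΓ]
  ring

/-- The scalar curvature of `exp (2 φ) G`. -/
theorem coordScalar_conformal (hG : IsCoordMetric G T) (hφ : ContDiffOn ℝ ∞ φ T)
    (hG' : ∀ z ∈ T, G' z = Real.exp (2 * φ z) • G z) (hy : y ∈ T) :
    coordScalar G' y = (Real.exp (2 * φ y))⁻¹ * (coordScalar G y
      - (n - 1) * (2 * coordLaplacian G φ y + (n - 2) * coordGradNormSq G φ y)) := by
  have hinv : ∀ a b, (G' y)⁻¹ a b = (Real.exp (2 * φ y))⁻¹ * (G y)⁻¹ a b := by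
    intro a b
    simp [hG.inv_of_eq_smul hy (Real.exp_ne_zero _) (hG' y hy)]
  have hsw : ∑ i, ∑ j, (G y)⁻¹ i j * pd j (pd i φ) y = ∑ i, ∑ j, (G y)⁻¹ i j * pd i (pd j φ) y := by
    rw [Finset.sum_comm]
    exact Finset.sum_congr rfl fun i _ => Finset.sum_congr rfl fun j _ => by rw [hG.inv_symm hy]
  have htr : ∑ i, ∑ j, (G y)⁻¹ i j * G y i j = n := by
    have : ∀ i, ∑ j, (G y)⁻¹ i j * G y i j = 1 := fun i => by
      rw [Finset.sum_congr rfl fun j _ => by rw [hG.symm hy i j], hG.sum_inv_mul hy, if_pos rfl]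
    simp [this]
  have hL : coordLaplacian G φ y = ∑ i, ∑ j, (G y)⁻¹ i j * pd i (pd j φ) y
      - ∑ i, ∑ j, (G y)⁻¹ i j * ∑ l, christoffel G l i j y * pd l φ y := by
    simp only [coordLaplacian, mul_sub, Finset.sum_sub_distrib]
  have hexpand : coordScalar G' y = (Real.exp (2 * φ y))⁻¹ * (∑ i, ∑ j, (G y)⁻¹ i j * ricci G i j y
      + (∑ i, ∑ j, (G y)⁻¹ i j * pd i (pd j φ) y + (1 - n) * ∑ i, ∑ j, (G y)⁻¹ i j * pd j (pd i φ) y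
        + (n - 2) * ∑ i, ∑ j, (G y)⁻¹ i j * ∑ l, christoffel G l i j y * pd l φ y
        + (n - 2) * ∑ i, ∑ j, (G y)⁻¹ i j * pd i φ y * pd j φ y
        - (coordLaplacian G φ y + (n - 2) * coordGradNormSq G φ y)
          * ∑ i, ∑ j, (G y)⁻¹ i j * G y i j)) := by
    simp only [coordScalar, hinv, hG.ricci_conformal hφ hG' hy]
    obtain ⟨Z, hZ⟩ : ∃ Z : Fin n → Fin n → ℝ,
        ∀ i j, ∑ l, christoffel G l i j y * pd l φ y = Z i j := ⟨_, fun _ _ => rfl⟩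
    simp only [hZ]
    generalize coordLaplacian G φ y + (n - 2) * coordGradNormSq G φ y = W
    simp only [Finset.mul_sum _ _ (Real.exp (2 * φ y))⁻¹, Finset.mul_sum _ _ ((1 : ℝ) - n),
      Finset.mul_sum _ _ ((n : ℝ) - 2), Finset.mul_sum _ _ W, ← Finset.sum_add_distrib,
      ← Finset.sum_sub_distrib]
    exact Finset.sum_congr rfl fun i _ => Finset.sum_congr rfl fun j _ => by ring
  rw [hexpand, hsw, htr, coordScalar]
  change _ * (_ + (_ + _ + _ + (n - 2) * coordGradNormSq G φ y - _)) = _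
  rw [hL]
  ring

end IsCoordMetric

end Conformal

section Harmonic

variable {n : ℕ} [NeZero n] {T : Set (EuclideanSpace ℝ (Fin n))}
  {G G' : EuclideanSpace ℝ (Fin n) → Matrix (Fin n) (Fin n) ℝ}
  {F K ψ : EuclideanSpace ℝ (Fin n) → ℝ} {y : EuclideanSpace ℝ (Fin n)}

theorem IsHalfOpen.coordLaplacian_congr (hT : IsHalfOpen T) (h : EqOn F K T) (hy : y ∈ T) :
    coordLaplacian G F y = coordLaplacian G K y := by
  have h1 : ∀ i, EqOn (pd i F) (pd i K) T := fun i z hz => hT.pd_congr h hz i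
  simp only [coordLaplacian, hT.pd_congr (h1 _) hy, h1 _ hy]

theorem IsHalfOpen.coordGradNormSq_congr (hT : IsHalfOpen T) (h : EqOn F K T) (hy : y ∈ T) :
    coordGradNormSq G F y = coordGradNormSq G K y := by
  simp only [coordGradNormSq, hT.pd_congr h hy]

/-- If `G` and `ψ G` are both scalar flat at `y`, then `ψ ^ ((n - 2) / 4)` is harmonic at `y`. -/
theorem IsCoordMetric.coordLaplacian_rpow_eq_zero (hn : 3 ≤ n) (hG : IsCoordMetric G T)
    (hψ : ContDiffOn ℝ ∞ ψ T) (hpos : ∀ z ∈ T, 0 < ψ z) (hG' : ∀ z ∈ T, G' z = ψ z • G z)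
    (hy : y ∈ T) (h : coordScalar G y = 0) (h' : coordScalar G' y = 0) :
    coordLaplacian G (fun z => ψ z ^ (((n : ℝ) - 2) / 4)) y = 0 := by
  have hT := hG.isHalfOpen
  set φ : EuclideanSpace ℝ (Fin n) → ℝ := fun z => Real.log (ψ z) / 2 with hφd
  have hφ : ContDiffOn ℝ ∞ φ T := (hψ.log fun z hz => (hpos z hz).ne').div_const 2
  have hexp : ∀ z ∈ T, ψ z = Real.exp (2 * φ z) := fun z hz => by
    rw [hφd, mul_div_cancel₀ _ two_ne_zero, Real.exp_log (hpos z hz)]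
  set c : ℝ := ((n : ℝ) - 2) / 2 with hc
  have hpow : EqOn (fun z => ψ z ^ (((n : ℝ) - 2) / 4)) (fun z => Real.exp (c * φ z)) T := by
    intro z hz
    simp only [Real.rpow_def_of_pos (hpos z hz), hφd, hc]
    congr 1
    ring
  have hs := hG.coordScalar_conformal (G' := G') hφ (fun z hz => by rw [hG' z hz, hexp z hz]) hy
  have hn' : (3 : ℝ) ≤ n := by exact_mod_cast hn
  rw [h, h', zero_sub, zero_eq_mul, neg_eq_zero, mul_eq_zero] at hs
  have hs' : 2 * coordLaplacian G φ y + (n - 2) * coordGradNormSq G φ y = 0 := by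
    rcases hs with h0 | h0 | h0
    · exact absurd h0 (inv_ne_zero (Real.exp_ne_zero _))
    · linarith
    · exact h0
  have d1 : ∀ t : ℝ, HasDerivAt (fun t : ℝ => Real.exp (c * t)) (c * Real.exp (c * t)) t :=
    fun t => by simpa [mul_comm] using ((hasDerivAt_id t).const_mul c).exp
  have d1' : deriv (fun t : ℝ => Real.exp (c * t)) = fun t => c * Real.exp (c * t) :=
    funext fun t => (d1 t).deriv
  have d2 : deriv (fun t : ℝ => c * Real.exp (c * t)) (φ y) = c * (c * Real.exp (c * φ y)) :=
    ((d1 (φ y)).const_mul c).deriv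
  rw [hT.coordLaplacian_congr hpow hy, coordLaplacian_comp (V := fun t => Real.exp (c * t)) hT hφ hy
    uniqueDiffOn_univ (mapsTo_univ _ _) (contDiff_const.mul contDiff_id).exp.contDiffOn,
    derivWithin_univ, derivWithin_univ, d1', d2]
  linear_combination (c * Real.exp (c * φ y) / 2) * hs'

end Harmonic

/-! ### The Hessian at critical points -/

section Critical

variable {n : ℕ} [NeZero n] {T : Set (EuclideanSpace ℝ (Fin n))}
  {G : EuclideanSpace ℝ (Fin n) → Matrix (Fin n) (Fin n) ℝ}
  {F : EuclideanSpace ℝ (Fin n) → ℝ} {y : EuclideanSpace ℝ (Fin n)} {J : Set ℝ} {b : ℝ → ℝ}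

theorem fderivWithin_eq_sum_pd (v : EuclideanSpace ℝ (Fin n)) :
    fderivWithin ℝ F (range (𝓡∂ n)) y v = ∑ i, v i * pd i F y := by
  conv_lhs => rw [← (EuclideanSpace.basisFun (Fin n) ℝ).sum_repr v]
  simp [pd]

/-- A function whose partial derivatives are bounded by a multiple of `|F - F y|` is constant
near `y`. -/
theorem IsHalfOpen.eventually_eq_of_abs_pd_le (hT : IsHalfOpen T) (hF : ContDiffOn ℝ ∞ F T)
    (hy : y ∈ T) {C : ℝ}
    (h : ∀ᶠ z in 𝓝[range (𝓡∂ n)] y, ∀ i, |pd i F z| ≤ C * |F z - F y|) :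
    ∀ᶠ z in 𝓝[range (𝓡∂ n)] y, F z = F y := by
  obtain ⟨ε, hε, hb⟩ := Metric.mem_nhdsWithin_iff.1 (inter_mem h (hT.mem_nhdsWithin hy))
  have hcv : Convex ℝ (Metric.ball y ε ∩ range (𝓡∂ n)) :=
    (convex_ball y ε).inter (𝓡∂ n).convex_range
  filter_upwards [inter_mem_nhdsWithin (range (𝓡∂ n)) (Metric.ball_mem_nhds y hε)] with z hz
  rw [inter_comm] at hz
  set γ : ℝ → EuclideanSpace ℝ (Fin n) := fun s => y + s • (z - y) with hγ
  have hγm : ∀ s ∈ Icc (0 : ℝ) 1, γ s ∈ Metric.ball y ε ∩ range (𝓡∂ n) := fun s hs =>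
    hcv.add_smul_sub_mem ⟨Metric.mem_ball_self hε, hT.subset_range hy⟩ hz hs
  have hγd : ∀ s, HasDerivAt γ (z - y) s := fun s => by
    have h1 := ((hasDerivAt_id s).smul_const (z - y)).const_add y
    rwa [one_smul] at h1
  have hw : ∀ s ∈ Icc (0 : ℝ) 1, HasDerivWithinAt (fun s => F (γ s) - F y)
      (∑ i, (z - y) i * pd i F (γ s)) (Icc 0 1) s := by
    intro s hs
    rw [← fderivWithin_eq_sum_pd]
    exact ((hT.differentiableWithinAt hF (hb (hγm s hs)).2).hasFDerivWithinAt.comp_hasDerivWithinAt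
      s (hγd s).hasDerivWithinAt fun t ht => (hγm t ht).2).sub_const _
  have h0 := eq_zero_of_abs_deriv_le_mul_abs_self_of_eq_zero_right
    (f := fun s => F (γ s) - F y) (f' := fun s => ∑ i, (z - y) i * pd i F (γ s))
    (K := (∑ i, |(z - y) i|) * C) (a := 0) (b := 1)
    (fun s hs => (hw s hs).continuousWithinAt)
    (fun s hs => (hw s (Ico_subset_Icc_self hs)).mono_of_mem_nhdsWithin
      (Icc_mem_nhdsGE_of_mem hs)) (by simp [hγ])
    (fun s hs => by
      rw [Real.norm_eq_abs, Real.norm_eq_abs, mul_assoc, Finset.sum_mul]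
      refine (Finset.abs_sum_le_sum_abs _ _).trans (Finset.sum_le_sum fun i _ => ?_)
      rw [abs_mul]
      exact mul_le_mul_of_nonneg_left ((hb (hγm s (Ico_subset_Icc_self hs))).1 i) (abs_nonneg _))
    1 (by simp)
  simpa [hγ, sub_eq_zero] using h0

/-- The matrix `E_{kj}` of the identity `∂_k (G^{ij} ∂_i F ∂_j F) = ∑_j E_{kj} ∂_j F`. -/
noncomputable def gradDeriv (G : EuclideanSpace ℝ (Fin n) → Matrix (Fin n) (Fin n) ℝ)
    (F : EuclideanSpace ℝ (Fin n) → ℝ) (z : EuclideanSpace ℝ (Fin n)) :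
    Matrix (Fin n) (Fin n) ℝ := fun k j =>
  ∑ i, (pd k (fun w => (G w)⁻¹ i j) z * pd i F z
    + ((G z)⁻¹ i j + (G z)⁻¹ j i) * pd k (pd i F) z)

namespace IsCoordMetric

theorem gradDeriv_contDiffOn (hG : IsCoordMetric G T) (hF : ContDiffOn ℝ ∞ F T) (k j : Fin n) :
    ContDiffOn ℝ ∞ (fun z => gradDeriv G F z k j) T := by
  have hT := hG.isHalfOpen
  have h1 := fun i => hT.pd_contDiffOn hF i
  unfold gradDeriv
  exact ContDiffOn.sum fun i _ => ((hT.pd_contDiffOn (hG.inv_contDiffOn i j) k).mul (h1 i)).add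
    (((hG.inv_contDiffOn i j).add (hG.inv_contDiffOn j i)).mul (hT.pd_contDiffOn (h1 i) k))

/-- The first derivatives of the equation `|∇F|² = b(F)`. -/
theorem sum_gradDeriv_mul_pd (hG : IsCoordMetric G T) (hF : ContDiffOn ℝ ∞ F T)
    (hFJ : MapsTo F T J) (hb : ContDiffOn ℝ ∞ b J)
    (hN : ∀ z ∈ T, coordGradNormSq G F z = b (F z)) (hy : y ∈ T) (k : Fin n) :
    ∑ j, gradDeriv G F y k j * pd j F y = derivWithin b J (F y) * pd k F y := by
  have hT := hG.isHalfOpen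
  have hr := hT.subset_range hy
  have hd := fun i => hT.differentiableWithinAt (hT.pd_contDiffOn hF i) hy
  have hA := fun i j => hT.differentiableWithinAt (hG.inv_contDiffOn i j) hy
  rw [← pd_comp hT hF hy hFJ (hb.differentiableOn (by simp) _ (hFJ hy)),
    ← hT.pd_congr (F := coordGradNormSq G F) hN hy]
  have h1 : ∀ i j, pd k (fun z => (G z)⁻¹ i j * pd i F z * pd j F z) y
      = pd k (fun w => (G w)⁻¹ i j) y * pd i F y * pd j F y
        + (G y)⁻¹ i j * pd k (pd i F) y * pd j F y
        + (G y)⁻¹ i j * pd k (pd j F) y * pd i F y := by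
    intro i j
    rw [pd_mul hr ((hA i j).fun_mul (hd i)) (hd j), pd_mul hr (hA i j) (hd i)]
    ring
  unfold coordGradNormSq
  rw [pd_sum hr fun i _ => DifferentiableWithinAt.fun_sum fun j _ =>
    ((hA i j).fun_mul (hd i)).fun_mul (hd j)]
  rw [Finset.sum_congr rfl fun i _ => pd_sum hr (fun j _ =>
    ((hA i j).fun_mul (hd i)).fun_mul (hd j)) k]
  simp only [h1, gradDeriv, Finset.sum_add_distrib, add_mul, Finset.sum_mul]
  rw [add_assoc]
  congr 1
  · exact Finset.sum_comm
  · congr 1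
    exact Finset.sum_comm

theorem gradDeriv_eq_of_critical (hG : IsCoordMetric G T) (hy : y ∈ T)
    (hcrit : ∀ i, pd i F y = 0) (k j : Fin n) :
    gradDeriv G F y k j = 2 * ∑ i, pd k (pd i F) y * (G y)⁻¹ i j := by
  simp only [gradDeriv, hcrit, Finset.mul_sum]
  exact Finset.sum_congr rfl fun i _ => by rw [hG.inv_symm hy j i]; ring

/-- The second derivatives of `|∇F|² = b(F)` at a critical point: with `H` the Hessian of `F` and
`A` the inverse of the metric, `2 H A Hᵀ = b'(F) Hᵀ`. -/
theorem hessian_mul_inv_mul_hessian (hG : IsCoordMetric G T) (hF : ContDiffOn ℝ ∞ F T)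
    (hJ : UniqueDiffOn ℝ J) (hFJ : MapsTo F T J) (hb : ContDiffOn ℝ ∞ b J)
    (hN : ∀ z ∈ T, coordGradNormSq G F z = b (F z)) (hy : y ∈ T) (hcrit : ∀ i, pd i F y = 0)
    (k l : Fin n) :
    2 * ∑ j, (∑ i, pd k (pd i F) y * (G y)⁻¹ i j) * pd l (pd j F) y
      = derivWithin b J (F y) * pd l (pd k F) y := by
  have hT := hG.isHalfOpen
  have hr := hT.subset_range hy
  have hd := fun i => hT.differentiableWithinAt (hT.pd_contDiffOn hF i) hy
  have hE := fun j => hT.differentiableWithinAt (hG.gradDeriv_contDiffOn hF k j) hy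
  have hb' : ContDiffOn ℝ ∞ (fun z => derivWithin b J (F z)) T :=
    (hb.derivWithin hJ (by simp)).comp hF hFJ
  have h := hT.pd_congr (F := fun z => ∑ j, gradDeriv G F z k j * pd j F z)
    (K := fun z => derivWithin b J (F z) * pd k F z)
    (fun z hz => hG.sum_gradDeriv_mul_pd hF hFJ hb hN hz k) hy l
  rw [pd_sum hr (fun j _ => (hE j).fun_mul (hd j)),
    pd_mul hr (hT.differentiableWithinAt hb' hy) (hd k), hcrit k, mul_zero, add_zero] at h
  rw [← h, Finset.mul_sum]
  refine Finset.sum_congr rfl fun j _ => ?_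
  rw [pd_mul hr (hE j) (hd j), hcrit j, mul_zero, add_zero, hG.gradDeriv_eq_of_critical hy hcrit]
  ring

end IsCoordMetric

/-- The trace of an idempotent matrix is a natural number, which vanishes only for the zero
matrix. -/
theorem exists_nat_trace_of_idempotent {ι : Type*} [Fintype ι] [DecidableEq ι] {P : Matrix ι ι ℝ}
    (hP : P * P = P) : ∃ r : ℕ, P.trace = r ∧ (r = 0 → P = 0) := by
  have h : IsIdempotentElem (Matrix.toLin' P) := by
    rw [IsIdempotentElem, Module.End.mul_eq_comp, ← Matrix.toLin'_mul, hP]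
  have htr : LinearMap.trace ℝ (ι → ℝ) (Matrix.toLin' P) = P.trace := Matrix.trace_toLin'_eq P
  refine ⟨_, htr ▸ (LinearMap.IsIdempotentElem.isProj_range _ h).trace, fun h0 => ?_⟩
  have := (LinearMap.IsIdempotentElem.isProj_range _ h).trace
  rw [h0, Nat.cast_zero] at this
  have h2 := LinearMap.IsIdempotentElem.eq_zero_of_trace_eq_zero h this
  simpa using h2

namespace IsCoordMetric

/-- At a critical point on a level where `b' ≠ 0`, the Laplacian is a natural multiple of `b' / 2`,
since `(2 / b') A H` is idempotent; it vanishes only if the Hessian does. -/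
theorem exists_nat_coordLaplacian (hG : IsCoordMetric G T) (hF : ContDiffOn ℝ ∞ F T)
    (hJ : UniqueDiffOn ℝ J) (hFJ : MapsTo F T J) (hb : ContDiffOn ℝ ∞ b J)
    (hN : ∀ z ∈ T, coordGradNormSq G F z = b (F z)) (hy : y ∈ T) (hcrit : ∀ i, pd i F y = 0)
    (hβ : derivWithin b J (F y) ≠ 0) :
    ∃ r : ℕ, coordLaplacian G F y = derivWithin b J (F y) / 2 * r ∧
      (r = 0 → ∀ i j, pd i (pd j F) y = 0) := by
  set β := derivWithin b J (F y)
  set H : Matrix (Fin n) (Fin n) ℝ := Matrix.of fun k i => pd k (pd i F) y with hH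
  set A := (G y)⁻¹ with hA
  have hAt : A.transpose = A := by
    ext i j
    exact hG.inv_symm hy j i
  have h1 : (2 : ℝ) • (H * A * H.transpose) = β • H.transpose := by
    ext k l
    simpa [Matrix.mul_apply, hH] using
      hG.hessian_mul_inv_mul_hessian hF hJ hFJ hb hN hy hcrit k l
  have h2 : (2 : ℝ) • (H * A * H.transpose) = β • H := by
    have := congrArg Matrix.transpose h1
    simpa [Matrix.transpose_mul, hAt, Matrix.mul_assoc] using this
  have hsymm : H.transpose = H := smul_right_injective _ hβ (h1.symm.trans h2)
  rw [hsymm] at h2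
  set P : Matrix (Fin n) (Fin n) ℝ := (2 / β) • (A * H) with hPdef
  have hP : P * P = P := by
    have : A * H * (A * H) = (β / 2) • (A * H) := by
      calc A * H * (A * H) = A * ((2 : ℝ)⁻¹ • (2 : ℝ) • (H * A * H)) := by
            rw [smul_smul, inv_mul_cancel₀ two_ne_zero, one_smul]
            simp only [Matrix.mul_assoc]
        _ = (β / 2) • (A * H) := by
            rw [h2, smul_smul, Matrix.mul_smul]
            congr 1
            ring
    rw [hPdef, Matrix.smul_mul, Matrix.mul_smul, this, smul_smul, smul_smul]
    congr 1
    field_simp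
  obtain ⟨r, hr, hr0⟩ := exists_nat_trace_of_idempotent hP
  have hL : coordLaplacian G F y = (A * H).trace := by
    rw [← hsymm]
    simp [coordLaplacian, hcrit, Matrix.trace, Matrix.mul_apply, hH, hA]
  refine ⟨r, ?_, fun h0 => ?_⟩
  · rw [hL, ← hr, hPdef, Matrix.trace_smul, smul_eq_mul]
    field_simp
  · have hAH : A * H = 0 := by
      have := hr0 h0
      rw [hPdef, smul_eq_zero] at this
      exact this.resolve_left (div_ne_zero two_ne_zero hβ)
    have hH0 : H = 0 := by
      rw [← Matrix.one_mul H, ← hG.mul_inv hy, Matrix.mul_assoc, hAH, Matrix.mul_zero]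
    intro i j
    exact congrFun (congrFun hH0 i) j

/-- If the Hessian vanishes at a critical point where `b' ≠ 0`, then the linear system
`E ∂F = b'(F) ∂F` is nondegenerate nearby, which forces `F` to be constant there. -/
theorem eventually_eq_of_hessian_eq_zero (hG : IsCoordMetric G T) (hF : ContDiffOn ℝ ∞ F T)
    (hJ : UniqueDiffOn ℝ J) (hFJ : MapsTo F T J) (hb : ContDiffOn ℝ ∞ b J)
    (hN : ∀ z ∈ T, coordGradNormSq G F z = b (F z)) (hy : y ∈ T) (hcrit : ∀ i, pd i F y = 0)
    (hβ : derivWithin b J (F y) ≠ 0) (hH : ∀ i j, pd i (pd j F) y = 0) :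
    ∀ᶠ z in 𝓝[range (𝓡∂ n)] y, F z = F y := by
  have hT := hG.isHalfOpen
  have hb' : ContDiffOn ℝ ∞ (fun z => derivWithin b J (F z)) T :=
    (hb.derivWithin hJ (by simp)).comp hF hFJ
  set N : EuclideanSpace ℝ (Fin n) → Matrix (Fin n) (Fin n) ℝ := fun z =>
    gradDeriv G F z - derivWithin b J (F z) • (1 : Matrix (Fin n) (Fin n) ℝ) with hNd
  have hNs : ∀ i j, ContDiffOn ℝ ∞ (fun z => N z i j) T := fun i j => by
    simp only [hNd, Matrix.sub_apply, Matrix.smul_apply, smul_eq_mul]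
    exact (hG.gradDeriv_contDiffOn hF i j).sub (hb'.mul contDiffOn_const)
  have hdet : (N y).det ≠ 0 := by
    have h0 : gradDeriv G F y = 0 := by
      ext k j
      simp [hG.gradDeriv_eq_of_critical hy hcrit, hH]
    simp [hNd, h0, Matrix.det_neg, hβ]
  have hcont : ContinuousWithinAt (fun z => (N z).det) T y :=
    (contDiffOn_det hNs).continuousOn y hy
  have hev : ∀ᶠ z in 𝓝[T] y, (N z).det ≠ 0 := hcont.eventually_ne hdet
  rw [hT.nhdsWithin_eq hy] at hev
  refine hT.eventually_eq_of_abs_pd_le hF hy (C := 0) ?_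
  filter_upwards [hev, hT.mem_nhdsWithin hy] with z hz hzT i
  have hv : (N z).mulVec (fun j => pd j F z) = 0 := by
    ext k
    rw [hNd, Matrix.sub_mulVec, Matrix.smul_mulVec, Matrix.one_mulVec]
    exact sub_eq_zero.2 (hG.sum_gradDeriv_mul_pd hF hFJ hb hN hzT k)
  have := congrFun (Matrix.eq_zero_of_mulVec_eq_zero hz hv) i
  simp only [Pi.zero_apply] at this
  simp [this]

end IsCoordMetric

end Critical

/-! ### Metrics and functions in charts -/

section Charts

variable {n : ℕ} [NeZero n] {M : Type*} [TopologicalSpace M]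
  [ChartedSpace (EuclideanHalfSpace n) M] [IsManifold (𝓡∂ n) ∞ M]

omit [IsManifold (𝓡∂ n) ∞ M] in
theorem isHalfOpen_target (x : M) : IsHalfOpen (extChartAt (𝓡∂ n) x).target := by
  refine ⟨(𝓡∂ n).symm ⁻¹' (chartAt (EuclideanHalfSpace n) x).target,
    (chartAt _ x).open_target.preimage (𝓡∂ n).continuous_symm, ?_⟩
  rw [extChartAt_target, inter_comm]

/-- The differential at `y` of the inverse of the preferred chart at `x`. -/
noncomputable def chartDeriv (x : M) (y : EuclideanSpace ℝ (Fin n)) :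
    EuclideanSpace ℝ (Fin n) →L[ℝ] TangentSpace (𝓡∂ n) ((extChartAt (𝓡∂ n) x).symm y) :=
  mfderivWithin 𝓘(ℝ, EuclideanSpace ℝ (Fin n)) (𝓡∂ n) (extChartAt (𝓡∂ n) x).symm
      (range (𝓡∂ n)) y

theorem gram_apply (g : SmoothMetric n M) (x : M) (y : EuclideanSpace ℝ (Fin n)) (i j : Fin n) :
    gram g x y i j = g.inner ((extChartAt (𝓡∂ n) x).symm y)
      (chartDeriv x y (EuclideanSpace.single i 1)) (chartDeriv x y (EuclideanSpace.single j 1)) :=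
  rfl

theorem chartDeriv_isInvertible {x : M} {y : EuclideanSpace ℝ (Fin n)}
    (hy : y ∈ (extChartAt (𝓡∂ n) x).target) : (chartDeriv x y).IsInvertible := by
  exact isInvertible_mfderivWithin_extChartAt_symm hy

omit [IsManifold (𝓡∂ n) ∞ M] in
theorem sum_smul_chartDeriv (x : M) (y v : EuclideanSpace ℝ (Fin n)) :
    ∑ i, v i • chartDeriv x y (EuclideanSpace.single i 1) = chartDeriv x y v := by
  conv_rhs => rw [← (EuclideanSpace.basisFun (Fin n) ℝ).sum_repr v]
  rw [map_sum]
  exact Finset.sum_congr rfl fun i _ => by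
    simpa using ((chartDeriv x y).map_smul (v i) (EuclideanSpace.single i 1)).symm

theorem gram_mulVec (g : SmoothMetric n M) (x : M) (y : EuclideanSpace ℝ (Fin n))
    (v w : EuclideanSpace ℝ (Fin n)) :
    g.inner ((extChartAt (𝓡∂ n) x).symm y) (chartDeriv x y v) (chartDeriv x y w)
      = ∑ i, ∑ j, v i * gram g x y i j * w j := by
  rw [← sum_smul_chartDeriv x y v, ← sum_smul_chartDeriv x y w]
  simp only [gram_apply, map_sum, map_smul, sum_apply, smul_apply, smul_eq_mul, Finset.mul_sum]
  rw [Finset.sum_comm]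
  exact Finset.sum_congr rfl fun i _ => Finset.sum_congr rfl fun j _ => by ring

theorem gram_posDef (g : SmoothMetric n M) {x : M} {y : EuclideanSpace ℝ (Fin n)}
    (hy : y ∈ (extChartAt (𝓡∂ n) x).target) : (gram g x y).PosDef := by
  refine Matrix.PosDef.of_dotProduct_mulVec_pos ?_ fun v hv => ?_
  · ext i j
    exact g.symm _ _ _
  · have h := g.pos _ (chartDeriv x y (WithLp.toLp 2 v)) fun h0 => hv ?_
    · rw [gram_mulVec] at h
      simpa [dotProduct, Matrix.mulVec, Finset.mul_sum, mul_assoc] using h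
    · have := (chartDeriv_isInvertible hy).injective (h0.trans (map_zero _).symm)
      exact congrArg WithLp.ofLp this

theorem contDiffOn_comp_symm {f : M → ℝ} (hf : ContMDiff (𝓡∂ n) 𝓘(ℝ, ℝ) ∞ f) (x : M) :
    ContDiffOn ℝ ∞ (f ∘ (extChartAt (𝓡∂ n) x).symm) (extChartAt (𝓡∂ n) x).target := by
  rw [← contMDiffOn_iff_contDiffOn]
  exact hf.comp_contMDiffOn (contMDiffOn_extChartAt_symm x)

theorem gram_contDiffOn (g : SmoothMetric n M) (x : M) (i j : Fin n) :
    ContDiffOn ℝ ∞ (fun y => gram g x y i j) (extChartAt (𝓡∂ n) x).target := by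
  have hT := isHalfOpen_target (n := n) x
  set T := (extChartAt (𝓡∂ n) x).target with hTd
  have hs : ContMDiffOn 𝓘(ℝ, EuclideanSpace ℝ (Fin n)) (𝓡∂ n) ∞ (extChartAt (𝓡∂ n) x).symm T :=
    contMDiffOn_extChartAt_symm x
  have hu : UniqueMDiffOn 𝓘(ℝ, EuclideanSpace ℝ (Fin n)) T := hT.uniqueDiffOn.uniqueMDiffOn
  have hX : ∀ i : Fin n, ContMDiffOn 𝓘(ℝ, EuclideanSpace ℝ (Fin n)) (𝓡∂ n).tangent ∞
      (fun y => (⟨(extChartAt (𝓡∂ n) x).symm y,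
        chartDeriv x y (EuclideanSpace.single i 1)⟩ : TangentBundle (𝓡∂ n) M)) T := by
    intro i
    have h1 := hs.contMDiffOn_tangentMapWithin (m := ∞) (by simp) hu
    have h2 : ContMDiffOn 𝓘(ℝ, EuclideanSpace ℝ (Fin n))
        (𝓘(ℝ, EuclideanSpace ℝ (Fin n))).tangent ∞
        (fun y : EuclideanSpace ℝ (Fin n) => (⟨y, EuclideanSpace.single i (1 : ℝ)⟩ :
          TangentBundle 𝓘(ℝ, EuclideanSpace ℝ (Fin n)) (EuclideanSpace ℝ (Fin n)))) T :=
      contMDiffOn_vectorSpace_iff_contDiffOn.2 contDiffOn_const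
    have h3 := h1.comp h2 (fun y hy => hy)
    refine h3.congr fun y hy => ?_
    simp only [chartDeriv, Function.comp_apply, tangentMapWithin]
    rw [mfderivWithin_subset hT.subset_range (hu y hy) (mdifferentiableWithinAt_extChartAt_symm hy)]
    rfl
  rw [← contMDiffOn_iff_contDiffOn]
  intro y hy
  have : ContMDiffWithinAt 𝓘(ℝ, EuclideanSpace ℝ (Fin n)) ((𝓡∂ n).prod 𝓘(ℝ)) ∞
      (fun y ↦ Bundle.TotalSpace.mk' ℝ (E := Bundle.Trivial M ℝ) ((extChartAt (𝓡∂ n) x).symm y)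
        (g.inner ((extChartAt (𝓡∂ n) x).symm y) (chartDeriv x y (EuclideanSpace.single i 1))
          (chartDeriv x y (EuclideanSpace.single j 1)))) T y := by
    apply ContMDiffWithinAt.clm_bundle_apply₂ (F₁ := EuclideanSpace ℝ (Fin n))
      (F₂ := EuclideanSpace ℝ (Fin n))
    · exact g.contMDiff.contMDiffAt.comp_contMDiffWithinAt y (hs y hy)
    · exact hX i y hy
    · exact hX j y hy
  simp only [Bundle.contMDiffWithinAt_totalSpace] at this
  exact this.2

theorem isCoordMetric_gram (g : SmoothMetric n M) (x : M) :
    IsCoordMetric (gram g x) (extChartAt (𝓡∂ n) x).target :=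
  ⟨isHalfOpen_target x, gram_contDiffOn g x, fun _ hy => gram_posDef g hy⟩

/-- The differential of a function, as a real linear form on the tangent space. -/
noncomputable def differential (f : M → ℝ) (p : M) : TangentSpace (𝓡∂ n) p →L[ℝ] ℝ :=
  mfderiv (𝓡∂ n) 𝓘(ℝ, ℝ) f p

/-- The partial derivatives of `f` in a chart are the values of `df` on the coordinate fields. -/
theorem pd_comp_symm {f : M → ℝ} (hf : ContMDiff (𝓡∂ n) 𝓘(ℝ, ℝ) ∞ f) {x : M}
    {y : EuclideanSpace ℝ (Fin n)} (hy : y ∈ (extChartAt (𝓡∂ n) x).target) (i : Fin n) :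
    pd i (f ∘ (extChartAt (𝓡∂ n) x).symm) y
      = differential (n := n) f ((extChartAt (𝓡∂ n) x).symm y)
        (chartDeriv x y (EuclideanSpace.single i 1)) := by
  have h1 := mfderiv_comp_mfderivWithin (I := 𝓘(ℝ, EuclideanSpace ℝ (Fin n))) (I' := 𝓡∂ n)
    (I'' := 𝓘(ℝ, ℝ)) (g := f) (f := (extChartAt (𝓡∂ n) x).symm) (s := range (𝓡∂ n)) y
    ((hf _).mdifferentiableAt (by simp)) (mdifferentiableWithinAt_extChartAt_symm hy)
    (uniqueDiffWithinAt_of_mem ((isHalfOpen_target x).subset_range hy)).uniqueMDiffWithinAt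
  rw [pd, ← mfderivWithin_eq_fderivWithin, h1]
  rfl

/-- The dual vector `v` of `df`, that is the gradient; the coordinate expression of the squared norm
of the gradient is `df(v)`. -/
theorem exists_gradient (g : SmoothMetric n M) {f : M → ℝ} (hf : ContMDiff (𝓡∂ n) 𝓘(ℝ, ℝ) ∞ f)
    {x p : M} {y : EuclideanSpace ℝ (Fin n)} (hy : y ∈ (extChartAt (𝓡∂ n) x).target)
    (hp : (extChartAt (𝓡∂ n) x).symm y = p) :
    ∃ v : TangentSpace (𝓡∂ n) p, (∀ w, g.inner p v w = differential (n := n) f p w) ∧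
      coordGradNormSq (gram g x) (f ∘ (extChartAt (𝓡∂ n) x).symm) y
        = differential (n := n) f p v := by
  subst hp
  have hG := isCoordMetric_gram g x
  set F := f ∘ (extChartAt (𝓡∂ n) x).symm with hF
  set p := (extChartAt (𝓡∂ n) x).symm y with hp
  set c : EuclideanSpace ℝ (Fin n) := WithLp.toLp 2 fun k => coordGrad (gram g x) F k y with hc
  have hpd : ∀ i, pd i F y = differential (n := n) f p
      (chartDeriv x y (EuclideanSpace.single i 1)) := fun i => pd_comp_symm hf hy i
  have hℓv : ∀ v : EuclideanSpace ℝ (Fin n),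
      differential (n := n) f p (chartDeriv x y v) = ∑ i, v i * pd i F y := by
    intro v
    rw [← sum_smul_chartDeriv, map_sum]
    exact Finset.sum_congr rfl fun i _ => by rw [hpd, map_smul, smul_eq_mul]
  refine ⟨chartDeriv x y c, fun w => ?_, ?_⟩
  · obtain ⟨v, rfl⟩ := (chartDeriv_isInvertible hy).surjective w
    rw [hℓv, gram_mulVec, Finset.sum_comm]
    refine Finset.sum_congr rfl fun j _ => ?_
    rw [← hG.sum_mul_coordGrad hy j, Finset.mul_sum]
    exact Finset.sum_congr rfl fun i _ => by rw [hG.symm hy i j]; simp only [hc]; ring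
  · rw [hℓv, ← IsCoordMetric.sum_coordGrad_mul_pd]

/-- The coordinate expression of the squared norm of the gradient is the same in all charts. -/
theorem coordGradNormSq_gram (g : SmoothMetric n M) {f : M → ℝ}
    (hf : ContMDiff (𝓡∂ n) 𝓘(ℝ, ℝ) ∞ f) {x : M} {y : EuclideanSpace ℝ (Fin n)}
    (hy : y ∈ (extChartAt (𝓡∂ n) x).target) :
    coordGradNormSq (gram g x) (f ∘ (extChartAt (𝓡∂ n) x).symm) y
      = gradNormSq g f ((extChartAt (𝓡∂ n) x).symm y) := by
  obtain ⟨v, hv, e⟩ := exists_gradient g hf hy rfl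
  obtain ⟨w, hw, e'⟩ := exists_gradient g hf
    (mem_extChartAt_target (I := 𝓡∂ n) ((extChartAt (𝓡∂ n) x).symm y)) (extChartAt_to_inv _)
  rw [e, gradNormSq, e']
  exact (hw v).symm.trans ((g.symm _ _ _).trans (hv w))

theorem gradNormSq_nonneg (g : SmoothMetric n M) {f : M → ℝ}
    (hf : ContMDiff (𝓡∂ n) 𝓘(ℝ, ℝ) ∞ f) (x : M) : 0 ≤ gradNormSq g f x := by
  obtain ⟨v, hv, e⟩ := exists_gradient g hf (mem_extChartAt_target (I := 𝓡∂ n) x)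
    (extChartAt_to_inv _)
  rw [gradNormSq, e]
  refine le_of_le_of_eq ?_ (hv v)
  by_cases h : v = 0
  · simp [h]
  · exact (g.pos x v h).le

theorem inner_sq_le (g : SmoothMetric n M) (x : M) (v w : TangentSpace (𝓡∂ n) x) :
    g.inner x v w ^ 2 ≤ g.inner x v v * g.inner x w w := by
  have h0 : ∀ u : TangentSpace (𝓡∂ n) x, 0 ≤ g.inner x u u := fun u => by
    by_cases h : u = 0
    · simp [h]
    · exact (g.pos x u h).le
  have h := discrim_le_zero (a := g.inner x w w) (b := 2 * g.inner x v w) (c := g.inner x v v)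
    fun t => by
      have := h0 (v + t • w)
      simp only [map_add, map_smul, add_apply, smul_apply, smul_eq_mul, g.symm x w v] at this
      linarith
  rw [discrim] at h
  linarith

/-- The Cauchy-Schwarz inequality `df(∂_i)² ≤ g(∂_i, ∂_i) ‖∇f‖²`. -/
theorem pd_sq_le (g : SmoothMetric n M) {f : M → ℝ}
    (hf : ContMDiff (𝓡∂ n) 𝓘(ℝ, ℝ) ∞ f) {x : M} {y : EuclideanSpace ℝ (Fin n)}
    (hy : y ∈ (extChartAt (𝓡∂ n) x).target) (i : Fin n) :
    pd i (f ∘ (extChartAt (𝓡∂ n) x).symm) y ^ 2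
      ≤ gram g x y i i * gradNormSq g f ((extChartAt (𝓡∂ n) x).symm y) := by
  obtain ⟨v, hv, e⟩ := exists_gradient g hf hy rfl
  rw [← coordGradNormSq_gram g hf hy, e, pd_comp_symm hf hy, gram_apply, mul_comm]
  have := inner_sq_le g _ v (chartDeriv x y (EuclideanSpace.single i 1))
  rw [hv, hv] at this
  exact this

/-! ### Conformal factors -/

theorem gram_of_isScaledBy {g h : SmoothMetric n M} {φ : M → ℝ} (hs : IsScaledBy h g φ) (x : M)
    (y : EuclideanSpace ℝ (Fin n)) :
    gram h x y = φ ((extChartAt (𝓡∂ n) x).symm y) • gram g x y := by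
  ext i j
  exact hs _ _ _

theorem gradNormSq_of_isScaledBy {g h : SmoothMetric n M} {φ : M → ℝ} (hs : IsScaledBy h g φ)
    {x : M} (hφ : 0 < φ x) (f : M → ℝ) : φ x * gradNormSq h f x = gradNormSq g f x := by
  have hy := mem_extChartAt_target (I := 𝓡∂ n) x
  have hG := isCoordMetric_gram g x
  have hinv : (gram h x (extChartAt (𝓡∂ n) x x))⁻¹
      = (φ x)⁻¹ • (gram g x (extChartAt (𝓡∂ n) x x))⁻¹ := by
    refine hG.inv_of_eq_smul hy hφ.ne' ?_
    rw [gram_of_isScaledBy hs, extChartAt_to_inv]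
  simp only [gradNormSq, coordGradNormSq, hinv, Matrix.smul_apply, smul_eq_mul, Finset.mul_sum]
  refine Finset.sum_congr rfl fun i _ => Finset.sum_congr rfl fun j _ => ?_
  field_simp

/-- A conformal factor between two scalar flat metrics is a power of a harmonic function. -/
theorem laplacian_rpow_eq_zero (hn : 3 ≤ n) {g h : SmoothMetric n M} {φ : M → ℝ}
    (hφ : ContMDiff (𝓡∂ n) 𝓘(ℝ, ℝ) ∞ φ) (hpos : ∀ x, 0 < φ x) (hs : IsScaledBy h g φ) {x : M}
    (hg0 : scalarCurvature g x = 0) (hh0 : scalarCurvature h x = 0) :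
    laplacian g (fun x => φ x ^ (((n : ℝ) - 2) / 4)) x = 0 :=
  (isCoordMetric_gram g x).coordLaplacian_rpow_eq_zero hn (contDiffOn_comp_symm hφ x)
    (fun _ _ => hpos _) (fun z _ => gram_of_isScaledBy hs x z) (mem_extChartAt_target x) hg0 hh0

end Charts

/-! ### One-variable analysis at an endpoint of the range -/

section OneVariable

variable {J : Set ℝ} {b b₁ b₂ a : ℝ → ℝ} {c m R κ : ℝ}

/-- First order Taylor expansion on an interval that may end at the base point. -/
theorem isBigO_taylor (hJ : UniqueDiffOn ℝ J) (hJc : Convex ℝ J) (hb : ContDiffOn ℝ ∞ b J)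
    (hc : c ∈ J) :
    (fun t => b t - b c - derivWithin b J c * (t - c)) =O[𝓝[J] c] fun t => (t - c) ^ 2 := by
  have hb' : ContDiffOn ℝ ∞ (derivWithin b J) J := hb.derivWithin hJ (by simp)
  obtain ⟨K, hK0, hK⟩ := ((hb'.differentiableOn (by simp)) c
    hc).hasDerivWithinAt.hasFDerivWithinAt.isBigO_sub.exists_nonneg
  obtain ⟨ε, hε, hball⟩ := Metric.mem_nhdsWithin_iff.1 hK.bound
  refine IsBigO.of_bound K ?_
  filter_upwards [inter_mem_nhdsWithin J (Metric.ball_mem_nhds c hε)] with t ht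
  have hsub : uIcc c t ⊆ J := by
    rw [← segment_eq_uIcc]; exact hJc.segment_subset hc ht.1
  have hd : ∀ s ∈ uIcc c t, HasDerivWithinAt (fun s => b s - derivWithin b J c * s)
      (derivWithin b J s - derivWithin b J c) (uIcc c t) s := fun s hs => by
    have h1 := (((hb.differentiableOn (by simp)) s (hsub hs)).hasDerivWithinAt).mono hsub
    simpa using h1.fun_sub ((hasDerivWithinAt_id s _).const_mul (derivWithin b J c))
  have hbd : ∀ s ∈ uIcc c t, ‖derivWithin b J s - derivWithin b J c‖ ≤ K * |t - c| := by
    intro s hs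
    have hst : |s - c| ≤ |t - c| := by
      simpa [abs_sub_comm] using abs_sub_left_of_mem_uIcc hs
    have hsb : s ∈ Metric.ball c ε ∩ J := by
      refine ⟨?_, hsub hs⟩
      have := ht.2
      rw [Metric.mem_ball, Real.dist_eq] at this ⊢
      exact hst.trans_lt this
    exact (hball hsb).trans (mul_le_mul_of_nonneg_left hst hK0)
  have := (convex_uIcc c t).norm_image_sub_le_of_norm_hasDerivWithin_le hd hbd left_mem_uIcc
    right_mem_uIcc
  rw [Real.norm_eq_abs, Real.norm_eq_abs] at *
  rw [abs_of_nonneg (sq_nonneg (t - c)), ← sq_abs, sq, ← mul_assoc]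
  convert this using 2
  ring

/-- The behaviour at the endpoint `m` of a smooth function with a simple zero there. -/
theorem simple_zero_asymptotics (hmR : m < R) (hb : ContDiffOn ℝ ∞ b (Icc m R)) (h0 : b m = 0)
    (hβ : derivWithin b (Icc m R) m ≠ 0) :
    (fun t => b t - derivWithin b (Icc m R) m * (t - m)) =O[𝓝[>] m] (fun t => (t - m) ^ 2) ∧
    (fun t => derivWithin b (Icc m R) t - derivWithin b (Icc m R) m) =O[𝓝[>] m] (fun t => t - m) ∧
    Tendsto (fun t => b t / (t - m)) (𝓝[>] m) (𝓝 (derivWithin b (Icc m R) m)) ∧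
    b =O[𝓝[>] m] (fun t => t - m) ∧ (fun t => t - m) =O[𝓝[>] m] b := by
  have hJ := uniqueDiffOn_Icc hmR
  have hm : m ∈ Icc m R := left_mem_Icc.2 hmR.le
  have hle : 𝓝[>] m ≤ 𝓝[Icc m R] m := by
    rw [nhdsWithin_Icc_eq_nhdsGE hmR]
    exact nhdsWithin_mono _ Ioi_subset_Ici_self
  have hb' : ContDiffOn ℝ ∞ (derivWithin b (Icc m R)) (Icc m R) := hb.derivWithin hJ (by simp)
  have h1 := (isBigO_taylor hJ (convex_Icc m R) hb hm).mono hle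
  simp only [h0, sub_zero] at h1
  have h2 : (fun t => derivWithin b (Icc m R) t - derivWithin b (Icc m R) m) =O[𝓝[>] m]
      (fun t => t - m) :=
    (((hb'.differentiableOn (by simp)) m hm).hasDerivWithinAt.hasFDerivWithinAt.isBigO_sub).mono hle
  have h3 : Tendsto (fun t => b t / (t - m)) (𝓝[>] m) (𝓝 (derivWithin b (Icc m R) m)) := by
    have h := hasDerivWithinAt_iff_tendsto_slope.1
      ((hb.differentiableOn (by simp)) m hm).hasDerivWithinAt
    have h' : 𝓝[>] m ≤ 𝓝[Icc m R \ {m}] m := by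
      rw [Icc_sdiff_left, nhdsWithin_Ioc_eq_nhdsGT hmR]
    refine (h.mono_left h').congr fun t => ?_
    rw [slope_def_field, h0, sub_zero]
  have hne : ∀ᶠ t in 𝓝[>] m, t - m ≠ 0 := by
    filter_upwards [self_mem_nhdsWithin] with t ht using (sub_pos.2 ht).ne'
  have h4 : b =O[𝓝[>] m] (fun t => t - m) := by
    have := (h3.isBigO_one ℝ).mul (isBigO_refl (fun t => t - m) (𝓝[>] m))
    refine this.congr' ?_ (by simp)
    filter_upwards [hne] with t ht using div_mul_cancel₀ _ ht
  have h5 : (fun t => t - m) =O[𝓝[>] m] b := by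
    have := ((h3.inv₀ hβ).isBigO_one ℝ).mul (isBigO_refl b (𝓝[>] m))
    have hb0 : ∀ᶠ t in 𝓝[>] m, b t / (t - m) ≠ 0 := h3.eventually_ne hβ
    refine this.congr' ?_ (by simp)
    filter_upwards [hb0] with t ht
    have := (div_ne_zero_iff.1 ht).1
    rw [inv_div, div_mul_cancel₀ _ this]
  exact ⟨h1, h2, h3, h4, h5⟩

/-- Let `b₁` and `b₂` have simple zeros at `m`. A power `U` of `b₁ / b₂` which solves
`U'' b₁ + U' a = 0` is constant, provided that `b₁' ≤ 2 a` at `m`. Indeed `P = U'² b₁` tends to `0`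
at `m`, since `U'` is bounded there, whereas `P' = U'² (b₁' - 2 a) ≤ K P` keeps `P` away from `0`
unless it vanishes. -/
theorem eq_of_ode_of_simple_zeros (hmR : m < R) (hb₁ : ContDiffOn ℝ ∞ b₁ (Icc m R))
    (hb₂ : ContDiffOn ℝ ∞ b₂ (Icc m R)) (ha : ContDiffOn ℝ ∞ a (Icc m R))
    (h₁ : b₁ m = 0) (h₂ : b₂ m = 0) (hβ₁ : derivWithin b₁ (Icc m R) m ≠ 0)
    (hβ₂ : derivWithin b₂ (Icc m R) m ≠ 0) (hpos₁ : ∀ t ∈ Ioo m R, 0 < b₁ t)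
    (hpos₂ : ∀ t ∈ Ioo m R, 0 < b₂ t) (ham : derivWithin b₁ (Icc m R) m ≤ 2 * a m)
    {W W' : ℝ → ℝ} (hW : ∀ t ∈ Ioo m R, HasDerivAt (fun t => (b₁ t / b₂ t) ^ κ) (W t) t)
    (hW' : ∀ t ∈ Ioo m R, HasDerivAt W (W' t) t)
    (hode : ∀ t ∈ Ioo m R, W' t * b₁ t + W t * a t = 0) :
    ∀ t ∈ Ioo m R, W t = 0 := by
  have hJ := uniqueDiffOn_Icc hmR
  have hm : m ∈ Icc m R := left_mem_Icc.2 hmR.le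
  have hle : 𝓝[>] m ≤ 𝓝[Icc m R] m := by
    rw [nhdsWithin_Icc_eq_nhdsGE hmR]
    exact nhdsWithin_mono _ Ioi_subset_Ici_self
  set β₁ := derivWithin b₁ (Icc m R) m with hβ₁d
  set β₂ := derivWithin b₂ (Icc m R) m with hβ₂d
  have hder : ∀ {b : ℝ → ℝ}, ContDiffOn ℝ ∞ b (Icc m R) → ∀ t ∈ Ioo m R,
      HasDerivAt b (derivWithin b (Icc m R) t) t := fun {b} hb t ht =>
    ((hb.differentiableOn (by simp)) t (Ioo_subset_Icc_self ht)).hasDerivWithinAt.hasDerivAt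
      (Icc_mem_nhds ht.1 ht.2)
  obtain ⟨A1, A2, A3, A4, A5⟩ := simple_zero_asymptotics hmR hb₁ h₁ hβ₁
  obtain ⟨B1, B2, B3, B4, B5⟩ := simple_zero_asymptotics hmR hb₂ h₂ hβ₂
  have hIoo : Ioo m R ∈ 𝓝[>] m := Ioo_mem_nhdsGT hmR
  have hquot : Tendsto (fun t => b₁ t / b₂ t) (𝓝[>] m) (𝓝 (β₁ / β₂)) := by
    refine (A3.div B3 hβ₂).congr' ?_
    filter_upwards [self_mem_nhdsWithin] with t ht
    exact div_div_div_cancel_right₀ (sub_pos.2 ht).ne' _ _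
  -- `W` is bounded near `m`: the terms of order `t - m` in `b₁' b₂ - b₁ b₂'` cancel.
  have hWO : W =O[𝓝[>] m] fun _ => (1 : ℝ) := by
    have hN : (fun t => derivWithin b₁ (Icc m R) t * b₂ t - b₁ t * derivWithin b₂ (Icc m R) t)
        =O[𝓝[>] m] fun t => b₂ t * b₂ t := by
      have e1 := A2.mul B4
      have e2 := B1.const_mul_left β₁
      have e3 := B2.mul A4
      have e4 := A1.const_mul_left β₂
      simp only [← sq] at e1 e3
      have e := ((e1.add e2).sub (e3.add e4)).trans ((B5.pow 2).congr_right fun t => sq (b₂ t))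
      refine e.congr_left fun t => ?_
      ring
    have hr : (fun t => (b₁ t / b₂ t) ^ (κ - 1)) =O[𝓝[>] m] fun _ => (1 : ℝ) :=
      (hquot.rpow_const (Or.inl (div_ne_zero hβ₁ hβ₂))).isBigO_one ℝ
    have hq : (fun t => (derivWithin b₁ (Icc m R) t * b₂ t - b₁ t * derivWithin b₂ (Icc m R) t)
        / b₂ t ^ 2) =O[𝓝[>] m] fun _ => (1 : ℝ) := by
      have := hN.mul (isBigO_refl (fun t => (b₂ t ^ 2)⁻¹) (𝓝[>] m))
      refine this.congr' (by simp [div_eq_mul_inv]) ?_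
      filter_upwards [hIoo] with t ht
      have := (hpos₂ t ht).ne'
      field_simp
    have := (hq.const_mul_left κ).mul hr
    refine this.congr' ?_ (by simp)
    filter_upwards [hIoo] with t ht
    have hd := ((hder hb₁ t ht).div (hder hb₂ t ht) (hpos₂ t ht).ne').rpow_const (p := κ)
      (Or.inl (div_pos (hpos₁ t ht) (hpos₂ t ht)).ne')
    rw [(hW t ht).unique hd]
    simp only [Pi.div_apply]
    ring
  have hPlim : Tendsto (fun t => W t ^ 2 * b₁ t) (𝓝[>] m) (𝓝 0) := by
    have hb0 : Tendsto b₁ (𝓝[>] m) (𝓝 0) := by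
      have := (hb₁.continuousOn m hm).mono_left hle
      rwa [h₁] at this
    have h := (hWO.pow 2).mul (isBigO_refl b₁ (𝓝[>] m))
    simp only [one_pow, one_mul] at h
    exact h.trans_tendsto hb0
  intro t₀ ht₀
  by_contra hne
  -- A bound `b₁' - 2 a ≤ K b₁` on `(m, t₀]`, first near `m` and then by compactness.
  obtain ⟨K, hK⟩ : ∃ K : ℝ, ∀ t ∈ Ioc m t₀, derivWithin b₁ (Icc m R) t - 2 * a t ≤ K * b₁ t := by
    set D : ℝ → ℝ := fun t => derivWithin b₁ (Icc m R) t - 2 * a t with hD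
    have hDs : ContDiffOn ℝ ∞ D (Icc m R) :=
      (hb₁.derivWithin hJ (by simp)).sub (contDiffOn_const.mul ha)
    have hDO : (fun t => D t - D m) =O[𝓝[>] m] b₁ :=
      ((((hDs.differentiableOn (by simp)) m
        hm).hasDerivWithinAt.hasFDerivWithinAt.isBigO_sub).mono hle).trans A5
    obtain ⟨K₁, hK₁⟩ := hDO.bound
    obtain ⟨u, hu, hu'⟩ := mem_nhdsGT_iff_exists_Ioo_subset.1 (inter_mem hK₁ hIoo)
    have hu0 : m < u := hu
    have hsub : Icc (min u t₀) t₀ ⊆ Ioo m R := fun t ht =>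
      ⟨(lt_min hu0 ht₀.1).trans_le ht.1, ht.2.trans_lt ht₀.2⟩
    obtain ⟨K₂, hK₂⟩ := isCompact_Icc.exists_bound_of_continuousOn (f := fun t => D t / b₁ t)
      (s := Icc (min u t₀) t₀) ((hDs.continuousOn.mono (hsub.trans Ioo_subset_Icc_self)).div
        (hb₁.continuousOn.mono (hsub.trans Ioo_subset_Icc_self))
        fun t ht => (hpos₁ t (hsub ht)).ne')
    refine ⟨max K₁ K₂, fun t ht => ?_⟩
    have htI : t ∈ Ioo m R := ⟨ht.1, ht.2.trans_lt ht₀.2⟩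
    have hp := hpos₁ t htI
    rcases lt_or_ge t u with h | h
    · have h3 := (hu' ⟨ht.1, h⟩).1
      simp only [mem_ofPred_eq, Real.norm_eq_abs, abs_of_pos hp] at h3
      have hDm : D m ≤ 0 := by simp only [hD]; linarith
      have := le_abs_self (D t - D m)
      have h4 := mul_le_mul_of_nonneg_right (le_max_left K₁ K₂) hp.le
      change D t ≤ _
      linarith
    · have h3 := hK₂ t ⟨(min_le_left _ _).trans h, ht.2⟩
      rw [Real.norm_eq_abs] at h3
      have h4 := (le_abs_self _).trans (h3.trans (le_max_right K₁ K₂))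
      exact (div_le_iff₀ hp).1 h4
  set Q : ℝ → ℝ := fun t => Real.exp (-K * t) * (W t ^ 2 * b₁ t) with hQ
  have hQd : ∀ t ∈ Ioc m t₀, HasDerivAt Q (Real.exp (-K * t) * (W t ^ 2 *
      (derivWithin b₁ (Icc m R) t - 2 * a t - K * b₁ t))) t := by
    intro t ht
    have htI : t ∈ Ioo m R := ⟨ht.1, ht.2.trans_lt ht₀.2⟩
    have h1 : HasDerivAt (fun t => Real.exp (-K * t)) (Real.exp (-K * t) * -K) t := by
      simpa using ((hasDerivAt_id t).const_mul (-K)).exp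
    have h2 := h1.mul (((hW' t htI).pow 2).mul (hder hb₁ t htI))
    refine h2.congr_deriv ?_
    have := hode t htI
    simp only [Pi.mul_apply, Pi.pow_apply]
    push_cast
    linear_combination (2 * Real.exp (-K * t) * W t) * this
  have hanti : AntitoneOn Q (Ioc m t₀) := by
    refine antitoneOn_of_deriv_nonpos (convex_Ioc m t₀)
      (fun t ht => (hQd t ht).continuousAt.continuousWithinAt) ?_ ?_
    · intro t ht
      rw [interior_Ioc] at ht
      exact (hQd t (Ioo_subset_Ioc_self ht)).differentiableAt.differentiableWithinAt
    · intro t ht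
      rw [interior_Ioc] at ht
      rw [(hQd t (Ioo_subset_Ioc_self ht)).deriv]
      refine mul_nonpos_of_nonneg_of_nonpos (Real.exp_pos _).le
        (mul_nonpos_of_nonneg_of_nonpos (sq_nonneg _) ?_)
      linarith [hK t (Ioo_subset_Ioc_self ht)]
  have hQlim : Tendsto Q (𝓝[>] m) (𝓝 0) := by
    have h1 : Tendsto (fun t => Real.exp (-K * t)) (𝓝[>] m) (𝓝 (Real.exp (-K * m))) :=
      ((Real.continuous_exp.comp (continuous_const.mul continuous_id)).tendsto m).mono_left
        nhdsWithin_le_nhds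
    have h2 := h1.mul hPlim
    rwa [mul_zero] at h2
  have hQ0 : 0 < Q t₀ := by
    have := hpos₁ t₀ ht₀
    positivity
  have := ge_of_tendsto hQlim (b := Q t₀) (by
    filter_upwards [Ioc_mem_nhdsGT ht₀.1] with t ht
    exact hanti ht (right_mem_Ioc.2 ht₀.1) ht.2)
  linarith

end OneVariable

/-! ### Level sets of isoparametric functions -/

section Levels

variable {n : ℕ} [NeZero n] {M : Type*} [TopologicalSpace M]
  [ChartedSpace (EuclideanHalfSpace n) M] [IsManifold (𝓡∂ n) ∞ M]

/-- `f` has range `[m, R]` with `m < R`, and satisfies `‖∇f‖² = b ∘ f` and `Δ f = a ∘ f`. -/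
structure IsIsoparametricWith (g : SmoothMetric n M) (f : M → ℝ) (m R : ℝ) (a b : ℝ → ℝ) :
    Prop where
  smooth : ContMDiff (𝓡∂ n) 𝓘(ℝ, ℝ) ∞ f
  lt : m < R
  range_eq : range f = Icc m R
  contDiffOn_a : ContDiffOn ℝ ∞ a (Icc m R)
  contDiffOn_b : ContDiffOn ℝ ∞ b (Icc m R)
  gradient : ∀ x, gradNormSq g f x = b (f x)
  laplace : ∀ x, laplacian g f x = a (f x)

theorem IsIsoparametric.exists_with {g : SmoothMetric n M} {f : M → ℝ} {m R : ℝ}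
    (hf : IsIsoparametric g f) (hr : range f = Icc m R) :
    ∃ a b, IsIsoparametricWith g f m R a b := by
  obtain ⟨b, hb, hgrad⟩ := hf.gradient
  obtain ⟨a, ha, hlap⟩ := hf.laplace
  rw [hr] at ha hb
  refine ⟨a, b, hf.smooth, ?_, hr, ha, hb, hgrad, hlap⟩
  by_contra hle
  refine hf.nonconstant ⟨m, fun x => ?_⟩
  have hx : f x ∈ Icc m R := hr ▸ mem_range_self x
  exact le_antisymm (hx.2.trans (not_lt.1 hle)) hx.1

omit [IsManifold (𝓡∂ n) ∞ M] in
theorem eventually_of_chart {p : M} {P : M → Prop}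
    (h : ∀ᶠ z in 𝓝[range (𝓡∂ n)] (extChartAt (𝓡∂ n) p p), P ((extChartAt (𝓡∂ n) p).symm z)) :
    ∀ᶠ x in 𝓝 p, P x := by
  rw [← map_extChartAt_symm_nhdsWithin_range (I := 𝓡∂ n) p]
  exact h

namespace IsIsoparametricWith

variable {g : SmoothMetric n M} {f : M → ℝ} {m R c : ℝ} {a b : ℝ → ℝ}

theorem mem_Icc (h : IsIsoparametricWith g f m R a b) (x : M) : f x ∈ Icc m R :=
  h.range_eq ▸ mem_range_self x

theorem b_nonneg (h : IsIsoparametricWith g f m R a b) (hc : c ∈ Icc m R) : 0 ≤ b c := by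
  rw [← h.range_eq] at hc
  obtain ⟨x, rfl⟩ := hc
  rw [← h.gradient]
  exact gradNormSq_nonneg g h.smooth x

/-- A level set is not open, since `M` is connected and `f` is not constant. -/
theorem exists_not_eventually_eq [PreconnectedSpace M] (h : IsIsoparametricWith g f m R a b)
    (hc : c ∈ Icc m R) : ∃ p, f p = c ∧ ¬ ∀ᶠ x in 𝓝 p, f x = c := by
  by_contra! hcon
  have hopen : IsOpen (f ⁻¹' {c}) := isOpen_iff_mem_nhds.2 fun p hp => hcon p hp
  have hclosed : IsClosed (f ⁻¹' {c}) := isClosed_singleton.preimage h.smooth.continuous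
  rw [← h.range_eq] at hc
  obtain ⟨p, hp⟩ := hc
  have huniv := IsClopen.eq_univ ⟨hclosed, hopen⟩ ⟨p, hp⟩
  have hall : ∀ t ∈ Icc m R, t = c := by
    intro t ht
    rw [← h.range_eq] at ht
    obtain ⟨x, rfl⟩ := ht
    exact (huniv ▸ mem_univ x : x ∈ f ⁻¹' {c})
  exact h.lt.ne ((hall m (left_mem_Icc.2 h.lt.le)).trans (hall R (right_mem_Icc.2 h.lt.le)).symm)

theorem pd_eq_zero (h : IsIsoparametricWith g f m R a b) {p : M} (hp : b (f p) = 0) (i : Fin n) :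
    pd i (f ∘ (extChartAt (𝓡∂ n) p).symm) (extChartAt (𝓡∂ n) p p) = 0 := by
  have := pd_sq_le g h.smooth (mem_extChartAt_target (I := 𝓡∂ n) p) i
  rw [extChartAt_to_inv, h.gradient, hp, mul_zero] at this
  exact pow_eq_zero_iff two_ne_zero |>.1 (le_antisymm this (sq_nonneg _))

/-- A zero `c` of `b` is simple: otherwise `‖∇f‖ ≤ C |f - c|`, and `f` would be locally constant on
the level `c`. -/
theorem derivWithin_ne_zero [PreconnectedSpace M] (h : IsIsoparametricWith g f m R a b)
    (hc : c ∈ Icc m R) (hbc : b c = 0) : derivWithin b (Icc m R) c ≠ 0 := by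
  intro h0
  obtain ⟨p, rfl, hp⟩ := h.exists_not_eventually_eq hc
  refine hp (eventually_of_chart (n := n) ?_)
  set y := extChartAt (𝓡∂ n) p p with hy
  set T := (extChartAt (𝓡∂ n) p).target
  set F := f ∘ (extChartAt (𝓡∂ n) p).symm with hF
  have hT : IsHalfOpen T := isHalfOpen_target p
  have hyT : y ∈ T := mem_extChartAt_target p
  have hFs : ContDiffOn ℝ ∞ F T := contDiffOn_comp_symm h.smooth p
  have hFy : F y = f p := congrArg f (extChartAt_to_inv p)
  obtain ⟨K, hK0, hK⟩ := (isBigO_taylor (uniqueDiffOn_Icc h.lt) (convex_Icc m R) h.contDiffOn_b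
    hc).exists_nonneg
  have hFc : Tendsto F (𝓝[range (𝓡∂ n)] y) (𝓝[Icc m R] (f p)) := by
    refine tendsto_nhdsWithin_iff.2 ⟨?_, Eventually.of_forall fun z => h.mem_Icc _⟩
    rw [← hT.nhdsWithin_eq hyT, ← hFy]
    exact hFs.continuousOn y hyT
  -- A common bound `D` for the coefficients `g(∂_i, ∂_i)` in the Cauchy-Schwarz inequality.
  have hdiag : ∀ᶠ z in 𝓝[range (𝓡∂ n)] y, ∀ i, gram g p z i i < gram g p y i i + 1 := by
    rw [eventually_all]
    intro i
    rw [← hT.nhdsWithin_eq hyT]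
    exact ((gram_contDiffOn g p i i).continuousOn y hyT).eventually_lt_const (lt_add_one _)
  set D := ∑ i, (|gram g p y i i| + 1) with hD
  have hDi : ∀ i, gram g p y i i + 1 ≤ D := fun i =>
    (add_le_add_left (le_abs_self _) 1).trans
      (Finset.single_le_sum (f := fun i => |gram g p y i i| + 1) (fun j _ => by positivity)
        (Finset.mem_univ i))
  have hD0 : 0 ≤ D := Finset.sum_nonneg fun i _ => by positivity
  have key := hT.eventually_eq_of_abs_pd_le hFs hyT (C := √(D * K)) ?_
  · filter_upwards [key] with z hz
    rw [← hFy]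
    exact hz
  filter_upwards [hFc.eventually hK.bound, hdiag, hT.mem_nhdsWithin hyT] with z hz hzd hzT i
  rw [hbc, h0, zero_mul, sub_zero, sub_zero, Real.norm_eq_abs, Real.norm_eq_abs,
    abs_of_nonneg (sq_nonneg (F z - f p))] at hz
  have h1 := pd_sq_le g h.smooth hzT i
  rw [h.gradient] at h1
  have hb0 : 0 ≤ b (F z) := h.b_nonneg (h.mem_Icc _)
  refine Real.abs_le_sqrt (y := D * K * (F z - F y) ^ 2) ?_ |>.trans_eq ?_
  · calc pd i F z ^ 2 ≤ gram g p z i i * b (F z) := h1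
      _ ≤ D * (K * (F z - F y) ^ 2) := by
        rw [hFy]
        exact mul_le_mul ((hzd i).le.trans (hDi i)) ((le_abs_self _).trans hz) hb0 hD0
      _ = _ := by ring
  · rw [Real.sqrt_mul (by positivity), Real.sqrt_sq_eq_abs]

/-- On a critical level, the Laplacian is a natural multiple of `b' / 2`. -/
theorem exists_nat_laplacian [PreconnectedSpace M] (h : IsIsoparametricWith g f m R a b) {p : M}
    (hp : b (f p) = 0) : ∃ r : ℕ, a (f p) = derivWithin b (Icc m R) (f p) / 2 * r ∧
      (r = 0 → ∀ᶠ x in 𝓝 p, f x = f p) := by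
  have hG := isCoordMetric_gram g p
  have hFs := contDiffOn_comp_symm (n := n) h.smooth p
  have hyT := mem_extChartAt_target (I := 𝓡∂ n) p
  have hFJ : MapsTo (f ∘ (extChartAt (𝓡∂ n) p).symm) (extChartAt (𝓡∂ n) p).target (Icc m R) :=
    fun z _ => h.mem_Icc _
  have hN : ∀ z ∈ (extChartAt (𝓡∂ n) p).target,
      coordGradNormSq (gram g p) (f ∘ (extChartAt (𝓡∂ n) p).symm) z
        = b ((f ∘ (extChartAt (𝓡∂ n) p).symm) z) := fun z hz => by
    rw [coordGradNormSq_gram g h.smooth hz, h.gradient]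
    rfl
  have hJ := uniqueDiffOn_Icc h.lt
  have hFy : (f ∘ (extChartAt (𝓡∂ n) p).symm) (extChartAt (𝓡∂ n) p p) = f p :=
    congrArg f (extChartAt_to_inv p)
  have hβ := h.derivWithin_ne_zero (h.mem_Icc p) hp
  rw [← hFy] at hβ
  obtain ⟨r, hr, hr0⟩ := hG.exists_nat_coordLaplacian hFs hJ hFJ h.contDiffOn_b hN hyT
    (h.pd_eq_zero hp) hβ
  refine ⟨r, ?_, fun h0 => eventually_of_chart (n := n) ?_⟩
  · rw [← h.laplace, laplacian, hr, hFy]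
  · have := hG.eventually_eq_of_hessian_eq_zero hFs hJ hFJ h.contDiffOn_b hN hyT
      (h.pd_eq_zero hp) hβ (hr0 h0)
    rwa [hFy] at this

/-- On a critical level the Laplacian does not vanish: its value `a c` determines the natural number
of `exists_nat_laplacian` for all points of the level at once, and if that number were zero, the
level set would be open. -/
theorem a_ne_zero [PreconnectedSpace M] (h : IsIsoparametricWith g f m R a b)
    (hc : c ∈ Icc m R) (hbc : b c = 0) : a c ≠ 0 := by
  intro h0
  obtain ⟨p, rfl, hp⟩ := h.exists_not_eventually_eq hc
  obtain ⟨r, hr, hr0⟩ := h.exists_nat_laplacian hbc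
  rw [h0, zero_eq_mul] at hr
  refine hp (hr0 ?_)
  exact_mod_cast hr.resolve_left (div_ne_zero (h.derivWithin_ne_zero hc hbc) two_ne_zero)

/-- All interior values are regular, since `b ≥ 0` cannot have a simple zero there. -/
theorem b_pos [PreconnectedSpace M] (h : IsIsoparametricWith g f m R a b)
    (hc : c ∈ Ioo m R) : 0 < b c := by
  refine lt_of_le_of_ne (h.b_nonneg (Ioo_subset_Icc_self hc)) fun h0 => ?_
  refine h.derivWithin_ne_zero (Ioo_subset_Icc_self hc) h0.symm ?_
  have hnhds : Icc m R ∈ 𝓝 c := Icc_mem_nhds hc.1 hc.2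
  rw [derivWithin_of_mem_nhds hnhds]
  refine IsLocalMin.deriv_eq_zero ?_
  filter_upwards [hnhds] with t ht
  rw [← h0]
  exact h.b_nonneg ht

/-- The natural number of `exists_nat_laplacian` is at least `1` on a critical minimal level. -/
theorem derivWithin_le [PreconnectedSpace M] (h : IsIsoparametricWith g f m R a b)
    (hb : b m = 0) : derivWithin b (Icc m R) m ≤ 2 * a m := by
  have hm : m ∈ Icc m R := left_mem_Icc.2 h.lt.le
  have hβ := h.derivWithin_ne_zero hm hb
  have ha := h.a_ne_zero hm hb
  have hβ0 : 0 ≤ derivWithin b (Icc m R) m := by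
    refine ge_of_tendsto (simple_zero_asymptotics h.lt h.contDiffOn_b hb hβ).2.2.1 ?_
    filter_upwards [Ioo_mem_nhdsGT h.lt] with t ht
    exact div_nonneg (h.b_nonneg (Ioo_subset_Icc_self ht)) (sub_nonneg.2 ht.1.le)
  obtain ⟨p, hp⟩ : m ∈ range f := h.range_eq ▸ hm
  subst hp
  obtain ⟨r, hr, -⟩ := h.exists_nat_laplacian hb
  have hr1 : (1 : ℝ) ≤ r := by
    have : r ≠ 0 := fun h0 => ha (by rw [hr, h0]; simp)
    exact_mod_cast Nat.one_le_iff_ne_zero.2 this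
  rw [hr]
  nlinarith

/-- Level sets have no interior points: `a` and `b` would both vanish there. -/
theorem not_eventually_eq [PreconnectedSpace M] (h : IsIsoparametricWith g f m R a b) (p : M) :
    ¬ ∀ᶠ x in 𝓝 p, f x = f p := by
  intro hev
  have hT := isHalfOpen_target (n := n) p
  have hyT := mem_extChartAt_target (I := 𝓡∂ n) p
  set F := f ∘ (extChartAt (𝓡∂ n) p).symm with hF
  obtain ⟨V, hV, hVo, hpV⟩ := mem_nhds_iff.1 hev
  set O := (extChartAt (𝓡∂ n) p).target ∩ (extChartAt (𝓡∂ n) p).symm ⁻¹' V with hO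
  have hOo : IsHalfOpen O := by
    obtain ⟨N, hN, h1⟩ := continuousOn_iff'.1 (continuousOn_extChartAt_symm (I := 𝓡∂ n) p) V hVo
    obtain ⟨N', hN', h2⟩ := hT
    refine ⟨N ∩ N', hN.inter hN', ?_⟩
    rw [hO, inter_comm, h1, h2]
    ext z
    simp only [mem_inter_iff]
    tauto
  have hyO : extChartAt (𝓡∂ n) p p ∈ O := 
    ⟨hyT, by rwa [mem_preimage, extChartAt_to_inv]⟩
  have hc : EqOn F (fun _ => f p) O := fun z hz => hV hz.2
  have hpd : ∀ i (z : EuclideanSpace ℝ (Fin n)), pd i (fun _ => f p) z = 0 :=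
    fun i z => pd_const _ _
  have hpd' : ∀ i, pd i (fun _ : EuclideanSpace ℝ (Fin n) => f p) = fun _ => 0 :=
    fun i => funext (hpd i)
  have hg : gradNormSq g f p = 0 := by
    rw [gradNormSq, hOo.coordGradNormSq_congr hc hyO]
    simp [coordGradNormSq, hpd]
  have hl : laplacian g f p = 0 := by
    rw [laplacian, hOo.coordLaplacian_congr hc hyO]
    simp [coordLaplacian, hpd', pd_const]
  exact h.a_ne_zero (h.mem_Icc p) ((h.gradient p).symm.trans hg) ((h.laplace p).symm.trans hl)

/-- The regular points are dense. -/
theorem dense_preimage_Ioo [PreconnectedSpace M] (h : IsIsoparametricWith g f m R a b) :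
    Dense (f ⁻¹' Ioo m R) := by
  intro p
  by_contra hp
  have hev : ∀ᶠ x in 𝓝 p, f x ∉ Ioo m R := by
    rw [mem_closure_iff_frequently, not_frequently] at hp
    exact hp
  have hcont := h.smooth.continuous.continuousAt (x := p)
  refine h.not_eventually_eq p ?_
  have hend : ∀ {t}, t ∈ Icc m R → t ∉ Ioo m R → t = m ∨ t = R := fun {t} h1 h2 => by
    by_contra! h3
    exact h2 ⟨lt_of_le_of_ne h1.1 h3.1.symm, lt_of_le_of_ne h1.2 h3.2⟩
  rcases hend (h.mem_Icc p) hev.self_of_nhds with h0 | h0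
  · filter_upwards [hev, hcont.eventually_lt_const (h0 ▸ h.lt)] with x hx hx'
    rw [h0]
    exact (hend (h.mem_Icc x) hx).resolve_right hx'.ne
  · filter_upwards [hev, hcont.eventually_const_lt (h0 ▸ h.lt)] with x hx hx'
    rw [h0]
    exact (hend (h.mem_Icc x) hx).resolve_left hx'.ne'

theorem b_eq_zero_of_interior (h : IsIsoparametricWith g f m R a b) {q : M}
    (hq : q ∉ (𝓡∂ n).boundary M) (hfq : f q = m) : b m = 0 := by
  have hint : range (𝓡∂ n) ∈ 𝓝 (extChartAt (𝓡∂ n) q q) := by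
    rw [← (𝓡∂ n).compl_interior, notMem_compl_iff] at hq
    exact mem_interior_iff_mem_nhds.1 hq
  have hpd : ∀ i, pd i (f ∘ (extChartAt (𝓡∂ n) q).symm) (extChartAt (𝓡∂ n) q q) = 0 := by
    intro i
    rw [pd, fderivWithin_of_mem_nhds hint, IsLocalMin.fderiv_eq_zero]
    · rfl
    · refine Eventually.of_forall fun z => ?_
      simp only [Function.comp_apply, extChartAt_to_inv, hfq]
      exact (h.mem_Icc _).1
  rw [← hfq, ← h.gradient, gradNormSq]
  simp only [coordGradNormSq, hpd, mul_zero, Finset.sum_const_zero]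

/-- If `f` attains its minimum in the interior, then a conformal factor `φ` between metrics for
which `f` is isoparametric is constant as soon as a power of it is harmonic. -/
theorem exists_rpow_eq_const [PreconnectedSpace M] {g' : SmoothMetric n M} {a' b' : ℝ → ℝ}
    (h : IsIsoparametricWith g f m R a b) (h' : IsIsoparametricWith g' f m R a' b')
    {φ : M → ℝ} (hφ : ContMDiff (𝓡∂ n) 𝓘(ℝ, ℝ) ∞ φ) (hpos : ∀ x, 0 < φ x)
    (hs : IsScaledBy g' g φ) {κ : ℝ} (hharm : ∀ x, laplacian g (fun x => φ x ^ κ) x = 0) {q : M}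
    (hq : q ∉ (𝓡∂ n).boundary M) (hfq : f q = m) : ∃ c, ∀ x, φ x ^ κ = c := by
  have hφb : ∀ x, f x ∈ Ioo m R → φ x = b (f x) / b' (f x) := fun x hx => by
    rw [eq_div_iff (h'.b_pos hx).ne', ← h.gradient, ← h'.gradient]
    exact gradNormSq_of_isScaledBy hs (hpos x) f
  have hsub : Ioo m R ⊆ Icc m R := Ioo_subset_Icc_self
  set U : ℝ → ℝ := fun t => (b t / b' t) ^ κ with hU
  have hquot : ∀ t ∈ Ioo m R, b t / b' t ≠ 0 := fun t ht =>
    (div_pos (h.b_pos ht) (h'.b_pos ht)).ne'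
  have hUs : ContDiffOn ℝ ∞ U (Ioo m R) :=
    ((h.contDiffOn_b.mono hsub).div (h'.contDiffOn_b.mono hsub)
      fun t ht => (h'.b_pos ht).ne').rpow_const_of_ne hquot
  have hJ : UniqueDiffOn ℝ (Ioo m R) := uniqueDiffOn_Ioo m R
  have hWs : ContDiffOn ℝ ∞ (derivWithin U (Ioo m R)) (Ioo m R) := hUs.derivWithin hJ (by simp)
  have hd : ∀ {V : ℝ → ℝ}, ContDiffOn ℝ ∞ V (Ioo m R) → ∀ t ∈ Ioo m R,
      HasDerivAt V (derivWithin V (Ioo m R) t) t := fun {V} hV t ht =>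
    ((hV.differentiableOn (by simp)) t ht).hasDerivWithinAt.hasDerivAt (Ioo_mem_nhds ht.1 ht.2)
  have hode : ∀ t ∈ Ioo m R, derivWithin (derivWithin U (Ioo m R)) (Ioo m R) t * b t
      + derivWithin U (Ioo m R) t * a t = 0 := by
    intro t ht
    obtain ⟨x, rfl⟩ : t ∈ range f := h.range_eq ▸ hsub ht
    have hFs := contDiffOn_comp_symm (n := n) h.smooth x
    have hT' := (isHalfOpen_target (n := n) x).inter_preimage hFs.continuousOn
      (isOpen_Ioo (a := m) (b := R))
    have hyT' : extChartAt (𝓡∂ n) x x ∈ (extChartAt (𝓡∂ n) x).target ∩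
        (f ∘ (extChartAt (𝓡∂ n) x).symm) ⁻¹' Ioo m R :=
      ⟨mem_extChartAt_target x, by rwa [mem_preimage, Function.comp_apply, extChartAt_to_inv]⟩
    have h1 := hharm x
    rw [laplacian, hT'.coordLaplacian_congr
      (K := fun z => U ((f ∘ (extChartAt (𝓡∂ n) x).symm) z)) (fun z hz => ?_) hyT',
      coordLaplacian_comp hT' (hFs.mono inter_subset_left) hyT' hJ (fun z hz => hz.2) hUs] at h1
    · have e1 := h.laplace x
      have e2 := h.gradient x
      rw [laplacian] at e1
      rw [gradNormSq] at e2
      rw [e1, e2] at h1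
      simp only [Function.comp_apply, extChartAt_to_inv] at h1
      linarith
    · simp only [Function.comp_apply, hU]
      rw [hφb _ hz.2]
  have hW := eq_of_ode_of_simple_zeros h.lt h.contDiffOn_b h'.contDiffOn_b h.contDiffOn_a
    (h.b_eq_zero_of_interior hq hfq) (h'.b_eq_zero_of_interior hq hfq)
    (h.derivWithin_ne_zero (left_mem_Icc.2 h.lt.le) (h.b_eq_zero_of_interior hq hfq))
    (h'.derivWithin_ne_zero (left_mem_Icc.2 h.lt.le) (h'.b_eq_zero_of_interior hq hfq))
    (fun t ht => h.b_pos ht) (fun t ht => h'.b_pos ht)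
    (h.derivWithin_le (h.b_eq_zero_of_interior hq hfq)) (hd hUs) (hd hWs) hode
  obtain ⟨t₀, ht₀⟩ := nonempty_Ioo.2 h.lt
  have hUc : ∀ t ∈ Ioo m R, U t = U t₀ := fun t ht =>
    isOpen_Ioo.is_const_of_deriv_eq_zero isPreconnected_Ioo (hUs.differentiableOn (by simp))
      (fun s hs => by rw [(hd hUs s hs).deriv, hW s hs]; rfl) ht ht₀
  have hcont : Continuous fun x => φ x ^ κ :=
    hφ.continuous.rpow_const fun x => Or.inl (hpos x).ne'
  refine ⟨U t₀, fun x => congrFun (hcont.ext_on h.dense_preimage_Ioo continuous_const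
    fun x hx => ?_) x⟩
  simp only [hφb x hx]
  exact hUc _ hx

end IsIsoparametricWith

theorem laplacian_neg (g : SmoothMetric n M) (f : M → ℝ) (x : M) :
    laplacian g (fun x => - f x) x = - laplacian g f x := by
  have hT := isHalfOpen_target (n := n) x
  have hy := mem_extChartAt_target (I := 𝓡∂ n) x
  set F := f ∘ (extChartAt (𝓡∂ n) x).symm with hF
  have h1 : ∀ i, EqOn (pd i fun z => - F z) (fun z => - pd i F z) (extChartAt (𝓡∂ n) x).target :=
    fun i z hz => pd_neg (hT.subset_range hz) i
  change coordLaplacian _ (fun z => - F z) _ = _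
  simp only [laplacian, coordLaplacian, h1 _ hy, hT.pd_congr (h1 _) hy,
    pd_neg (hT.subset_range hy), ← hF, ← Finset.sum_neg_distrib]
  refine Finset.sum_congr rfl fun i _ => Finset.sum_congr rfl fun j _ => ?_
  simp only [mul_neg, Finset.sum_neg_distrib]
  ring

theorem gradNormSq_neg (g : SmoothMetric n M) (f : M → ℝ) (x : M) :
    gradNormSq g (fun x => - f x) x = gradNormSq g f x := by
  have hr := (isHalfOpen_target (n := n) x).subset_range (mem_extChartAt_target (I := 𝓡∂ n) x)
  set F := f ∘ (extChartAt (𝓡∂ n) x).symm with hF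
  change coordGradNormSq _ (fun z => - F z) _ = _
  simp only [gradNormSq, coordGradNormSq, pd_neg hr, ← hF]
  exact Finset.sum_congr rfl fun i _ => Finset.sum_congr rfl fun j _ => by ring

theorem IsIsoparametric.neg {g : SmoothMetric n M} {f : M → ℝ} (hf : IsIsoparametric g f) :
    IsIsoparametric g (fun x => - f x) := by
  have hmaps : MapsTo (fun t : ℝ => - t) (range fun x => - f x) (range f) := by
    rintro _ ⟨x, rfl⟩
    exact ⟨x, (neg_neg _).symm⟩
  obtain ⟨b, hb, hgrad⟩ := hf.gradient
  obtain ⟨a, ha, hlap⟩ := hf.laplace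
  refine ⟨hf.smooth.neg, fun ⟨c, hc⟩ => hf.nonconstant ⟨-c, fun x => by rw [← hc x, neg_neg]⟩,
    ⟨fun t => b (-t), hb.comp contDiff_neg.contDiffOn hmaps, fun x => ?_⟩,
    ⟨fun t => - a (-t), (ha.comp contDiff_neg.contDiffOn hmaps).neg, fun x => ?_⟩,
    hf.boundary.comp fun t : ℝ => -t⟩
  · simp only [gradNormSq_neg, hgrad, neg_neg]
  · simp only [laplacian_neg, hlap, neg_neg]

/-- The function `f` is constant on the connected boundary, so that at least one of its extrema is
attained in the interior. -/
theorem IsIsoparametric.exists_interior_extremum [CompactSpace M] [ConnectedSpace M]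
    {g : SmoothMetric n M} {f : M → ℝ} (hbdry : IsConnected ((𝓡∂ n).boundary M))
    (hf : IsIsoparametric g f) :
    ∃ q, q ∉ (𝓡∂ n).boundary M ∧ ((∀ x, f q ≤ f x) ∨ ∀ x, f x ≤ f q) := by
  obtain ⟨p, -, hp⟩ := isCompact_univ.exists_isMinOn univ_nonempty hf.smooth.continuous.continuousOn
  obtain ⟨r, -, hr⟩ := isCompact_univ.exists_isMaxOn univ_nonempty hf.smooth.continuous.continuousOn
  have hp' : ∀ x, f p ≤ f x := fun x => hp (mem_univ x)
  have hr' : ∀ x, f x ≤ f r := fun x => hr (mem_univ x)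
  by_cases h1 : p ∈ (𝓡∂ n).boundary M
  · by_cases h2 : r ∈ (𝓡∂ n).boundary M
    · have : PreconnectedSpace ((𝓡∂ n).boundary M) :=
        isPreconnected_iff_preconnectedSpace.1 hbdry.isPreconnected
      have h3 : f p = f r := hf.boundary.apply_eq_of_preconnectedSpace ⟨p, h1⟩ ⟨r, h2⟩
      exact absurd ⟨f p, fun x => le_antisymm (h3 ▸ hr' x) (hp' x)⟩ hf.nonconstant
    · exact ⟨r, h2, Or.inr hr'⟩
  · exact ⟨p, h1, Or.inl hp'⟩

/-- A conformal factor between metrics for which `f` is isoparametric is constant as soon as a power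
of it is harmonic. -/
theorem exists_rpow_eq_const [CompactSpace M] [ConnectedSpace M] {g g' : SmoothMetric n M}
    {f : M → ℝ} (hbdry : IsConnected ((𝓡∂ n).boundary M)) (hf : IsIsoparametric g f)
    (hf' : IsIsoparametric g' f) {φ : M → ℝ} (hφ : ContMDiff (𝓡∂ n) 𝓘(ℝ, ℝ) ∞ φ)
    (hpos : ∀ x, 0 < φ x) (hs : IsScaledBy g' g φ) {κ : ℝ}
    (hharm : ∀ x, laplacian g (fun x => φ x ^ κ) x = 0) : ∃ c, ∀ x, φ x ^ κ = c := by
  have key : ∀ {f : M → ℝ}, IsIsoparametric g f → IsIsoparametric g' f →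
      ∀ q, q ∉ (𝓡∂ n).boundary M → (∀ x, f q ≤ f x) → ∃ c, ∀ x, φ x ^ κ = c := by
    intro f hf hf' q hq hmin
    have hr := eq_Icc_of_connected_compact (isConnected_range hf.smooth.continuous)
      (isCompact_range hf.smooth.continuous)
    have hleast : IsLeast (range f) (f q) := ⟨mem_range_self q, by rintro _ ⟨x, rfl⟩; exact hmin x⟩
    rw [hleast.csInf_eq] at hr
    obtain ⟨a, b, h⟩ := hf.exists_with hr
    obtain ⟨a', b', h'⟩ := hf'.exists_with hr
    exact h.exists_rpow_eq_const h' hφ hpos hs hharm hq rfl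
  obtain ⟨q, hq, h | h⟩ := hf.exists_interior_extremum hbdry
  · exact key hf hf' q hq h
  · exact key hf.neg hf'.neg q hq fun x => neg_le_neg (h x)

end Levels

/-! ### Homothetic metrics -/

section Homothety

variable {n : ℕ} [NeZero n] {M : Type*} [TopologicalSpace M]
  [ChartedSpace (EuclideanHalfSpace n) M] [IsManifold (𝓡∂ n) ∞ M]

theorem volumeMeasure_le_of_isScaledBy_const [MeasurableSpace M] {g h : SmoothMetric n M} {k : ℝ}
    (hk : 0 ≤ k) (hs : IsScaledBy h g fun _ => k) :
    volumeMeasure h ≤ ENNReal.ofReal √(k ^ n) • volumeMeasure g := by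
  refine iSup_le fun x => ?_
  have : (fun y => ENNReal.ofReal √((gram h x y).det))
      = ENNReal.ofReal √(k ^ n) • fun y => ENNReal.ofReal √((gram g x y).det) := by
    funext y
    rw [gram_of_isScaledBy hs, Matrix.det_smul, Fintype.card_fin, Real.sqrt_mul (by positivity),
      ENNReal.ofReal_mul (Real.sqrt_nonneg _)]
    rfl
  rw [this, withDensity_smul' _ _ ENNReal.ofReal_ne_top, Measure.map_smul]
  gcongr
  exact le_iSup (fun x : M => Measure.map (extChartAt (𝓡∂ n) x).symm
    ((volume.restrict (extChartAt (𝓡∂ n) x).target).withDensity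
      fun y => ENNReal.ofReal √((gram g x y).det))) x

/-- For `k < 1` the volume of `k g` would be smaller than that of `g`. -/
theorem one_le_of_volume_eq_one [MeasurableSpace M] {g h : SmoothMetric n M} {k : ℝ} (hk : 0 ≤ k)
    (hs : IsScaledBy h g fun _ => k) (hg : volumeMeasure g univ = 1)
    (hh : volumeMeasure h univ = 1) : 1 ≤ k := by
  have h1 := volumeMeasure_le_of_isScaledBy_const hk hs univ
  rw [Measure.smul_apply, hg, hh, smul_eq_mul, mul_one, ENNReal.one_le_ofReal,
    Real.one_le_sqrt] at h1
  exact (one_le_pow_iff_of_nonneg hk (NeZero.ne n)).1 h1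

theorem eq_of_isScaledBy_const [MeasurableSpace M] {g h : SmoothMetric n M} {k : ℝ} (hk : 0 < k)
    (hs : IsScaledBy h g fun _ => k) (hg : volumeMeasure g univ = 1)
    (hh : volumeMeasure h univ = 1) : g = h := by
  have hs' : IsScaledBy g h fun _ => k⁻¹ := fun x v w => by
    rw [hs, inv_mul_cancel_left₀ hk.ne']
  have hk1 : k = 1 := le_antisymm
    ((one_le_inv₀ hk).1 (one_le_of_volume_eq_one (inv_nonneg.2 hk.le) hs' hh hg))
    (one_le_of_volume_eq_one hk.le hs hg hh)
  have hinner : g.inner = h.inner := by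
    funext x
    ext v w
    rw [hs, hk1, one_mul]
  cases g
  cases h
  congr

end Homothety

end BoundaryConformal

theorem mainTheorem8 {n : ℕ} [NeZero n] (hn : 3 ≤ n)
    {M : Type*} [TopologicalSpace M] [ChartedSpace (EuclideanHalfSpace n) M]
    [IsManifold (𝓡∂ n) ∞ M] [T2Space M] [CompactSpace M] [ConnectedSpace M]
    [MeasurableSpace M] [BorelSpace M]
    (hbdry : IsConnected ((𝓡∂ n).boundary M))
    (g : SmoothMetric n M) (f : M → ℝ) (hf : IsIsoparametric g f) :
    {h ∈ isoparametricClass g f |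
      volumeMeasure h univ = 1 ∧ IsScalarFlatCMC h}.Subsingleton ∧
    ∀ g₁ ∈ isoparametricClass g f, ∀ g₂ ∈ isoparametricClass g f,
      IsScalarFlatCMC g₁ → IsScalarFlatCMC g₂ →
      ∃ u : M → ℝ, ContMDiff (𝓡∂ n) 𝓘(ℝ, ℝ) ∞ u ∧ (∀ x, 0 < u x) ∧
        IsScaledBy g₂ g₁ (fun x => u x ^ (4 / ((n : ℝ) - 2))) ∧
        (∀ x, laplacian g₁ u x = 0) ∧
        (∃ c : ℝ, ∀ x ∈ (𝓡∂ n).boundary M, u x = c) ∧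
        ∃ c : ℝ, ∀ x, u x = c := by
  have key : ∀ g₁ ∈ isoparametricClass g f, ∀ g₂ ∈ isoparametricClass g f,
      IsScalarFlatCMC g₁ → IsScalarFlatCMC g₂ →
      ∃ u : M → ℝ, ContMDiff (𝓡∂ n) 𝓘(ℝ, ℝ) ∞ u ∧ (∀ x, 0 < u x) ∧
        IsScaledBy g₂ g₁ (fun x => u x ^ (4 / ((n : ℝ) - 2))) ∧
        (∀ x, laplacian g₁ u x = 0) ∧ ∃ c : ℝ, ∀ x, u x = c := by
    rintro g₁ ⟨⟨φ₁, hφ₁, hp₁, hs₁⟩, hf₁⟩ g₂ ⟨⟨φ₂, hφ₂, hp₂, hs₂⟩, hf₂⟩ ⟨h₁, -⟩ ⟨h₂, -⟩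
    set φ : M → ℝ := fun x => φ₂ x / φ₁ x with hφd
    have hφ : ContMDiff (𝓡∂ n) 𝓘(ℝ, ℝ) ∞ φ := hφ₂.div₀ hφ₁ fun x => (hp₁ x).ne'
    have hpos : ∀ x, 0 < φ x := fun x => div_pos (hp₂ x) (hp₁ x)
    have hs : IsScaledBy g₂ g₁ φ := fun x v w => by
      have := (hp₁ x).ne'
      rw [hs₁, hs₂, hφd]
      field_simp
    have hn' : (n : ℝ) - 2 ≠ 0 := by
      have : (3 : ℝ) ≤ n := by exact_mod_cast hn
      linarith
    have hharm := fun x => laplacian_rpow_eq_zero hn hφ hpos hs (h₁ x) (h₂ x)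
    refine ⟨fun x => φ x ^ (((n : ℝ) - 2) / 4), fun x => ?_,
      fun x => Real.rpow_pos_of_pos (hpos x) _,
      fun x v w => ?_, hharm, exists_rpow_eq_const hbdry hf₁ hf₂ hφ hpos hs hharm⟩
    · exact (Real.contDiffAt_rpow_const_of_ne (hpos x).ne').contMDiffAt.comp x (hφ x)
    · beta_reduce
      rw [hs x v w, ← Real.rpow_mul (hpos x).le, div_mul_div_cancel₀ (by norm_num : (4 : ℝ) ≠ 0)]
      rw [div_self hn', Real.rpow_one]
  refine ⟨?_, fun g₁ hg₁ g₂ hg₂ h₁ h₂ => ?_⟩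
  · rintro g₁ ⟨hg₁, hv₁, h₁⟩ g₂ ⟨hg₂, hv₂, h₂⟩
    obtain ⟨u, -, hu0, hs, -, c, hc⟩ := key g₁ hg₁ g₂ hg₂ h₁ h₂
    simp only [hc] at hs hu0
    obtain ⟨x⟩ : Nonempty M := inferInstance
    exact eq_of_isScaledBy_const (Real.rpow_pos_of_pos (hu0 x) _) hs hv₁ hv₂
  · obtain ⟨u, hu, hu0, hs, hharm, c, hc⟩ := key g₁ hg₁ g₂ hg₂ h₁ h₂
    exact ⟨u, hu, hu0, hs, hharm, ⟨c, fun x _ => hc x⟩, c, hc⟩
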